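/- For real $\alpha,\beta$ let $\mathcal F_{\alpha\beta}$ be the equation $u_t+xu_y=|x-\alpha|^\beta u_{xx}$ for $u=u(t,x,y)$, considered on $x\ne\alpha$ (as a subset of the second-order jet space), and let $\mathcal F'_\beta:=\mathcal F_{0\beta}$. Let $\mathcal F=\{\mathcal F_{\alpha\beta}\}$ and $\mathcal F'=\{\mathcal F'_\beta\}$ be the classes of these equations, with arbitrary elements $\theta=(\alpha,\beta)\in\mathbb R^2$ and $\theta=\beta\in\mathbb R$, respectively. A point transformation is a $C^\infty$-diffeomorphism between nonempty open subsets of a space; transformations with the same domain and the same values are identified. The equivalence groupoid $\mathcal G^\sim$ of a class $\{\mathcal L_\theta\}$ consists of the admissible transformations, i.e. the triples $(\theta,\Phi,\tilde\theta)$ with a point transformation $\Phi$ in the space of $(t,x,y,u)$ such that $\Phi_*\mathcal L_\theta=\mathcal L_{\tilde\theta}$ (the second prolongation of $\Phi$ matches, wherever it is defined, the points of $\mathcal L_\theta$ with those of $\mathcal L_{\tilde\theta}$). The fundamental groupoid $\mathcal G^{\rm f}\subseteq\mathcal G^\sim$ consists of the admissible transformations with $\tilde\theta=\theta$. A (usual)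 equivalence transformation of the class is a point transformation $\Psi$ in the space of $(t,x,y,u,\theta)$, defined for all values of $\theta$, that projects to a transformation $\pi_*\Psi$ of $(t,x,y,u)$ and maps each constant value $\theta$ to a constant value $\Psi\theta$ with $(\theta,\pi_*\Psi,\Psi\theta)\in\mathcal G^\sim$. The action groupoid of a set $H$ of such transformations consists of the triples $(\theta,\pi_*\Psi,\Psi\theta)$ with $\Psi\in H$. The Frobenius product $A\star B$ of two sets of triples consists of all compositions (with nonempty domain) of an element of $A$ followed by an element of $B$ whose source is the target of the former. An equivalence transformation is discrete if it cannot be joined to the identity, even after restricting domains, by a continuous family of equivalence transformations of the class. **Theorem.** (i) The transformations $\mathscr S(c)\colon(t,x,y,u,\alpha,\beta)\mapsto(t,\,x+c,\,y+ct,\,u,\,\alpha+c,\,\beta)$, $c\in\mathbb R$, constitute a one-parameter group of equivalence transformations of the class $\mathcal F$. (ii) For all $(\alpha,\beta)\in\mathbb R^2$, the triple $\mathcal S_{\alpha\beta}:=\big((\alpha,\beta),\pi_*\mathscr S(-\alpha),(0,\beta)\big)$ is an admissible transformation of $\mathcal F$ that belongs to the action groupoid of the equivalence group of $\mathcal F$.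 The family of all $\mathcal S_{\alpha\beta}$ is wide (every $(\alpha,\beta)$ is the source of one of its elements) and maps the class $\mathcal F$ onto the class $\mathcal F'$, interpreted as the subclass $\alpha=0$ of $\mathcal F$; each $\mathcal S_{\alpha\beta}$ maps $\mathcal F_{\alpha\beta}$ to $\mathcal F'_\beta$. (iii) The transformation $\mathscr J'\colon(t,x,y,u,\beta)\mapsto\big(y\,\mathrm{sgn}\,x,\ 1/x,\ t\,\mathrm{sgn}\,x,\ u/x,\ 5-\beta\big)$, defined for $x\neq0$, is a discrete equivalence transformation of the class $\mathcal F'$. (iv) The class $\mathcal F'$ is semi-normalized with respect to the (pseudo)group $H$ generated by $\mathscr J'$. That is, $H$ consists of equivalence transformations of $\mathcal F'$, and the equivalence groupoid of $\mathcal F'$ is the Frobenius product of the action groupoid of $H$ and the fundamental groupoid of $\mathcal F'$, in either order of the factors. -/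

import Mathlib

open Set Topology
open scoped ContDiff

noncomputable section

namespace KolmogorovBackward

/-! ### Variables and jets -/

/-- The space of independent variables `(t, x, y)`. -/
abbrev Base : Type := ℝ × ℝ × ℝ

/-- The space of all variables `((t, x, y), u)`. -/
abbrev Vars : Type := Base × ℝ

/-- Partial derivatives of a function of `(t, x, y)`. -/
def dt (f : Base → ℝ) (p : Base) : ℝ := fderiv ℝ f p (1, 0, 0)
def dx (f : Base → ℝ) (p : Base) : ℝ := fderiv ℝ f p (0, 1, 0)
def dy (f : Base → ℝ) (p : Base) : ℝ := fderiv ℝ f p (0, 0, 1)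

/-- Points of the second-order jet space `J²` with three independent variables `t, x, y` and one
dependent variable `u`. -/
structure Jet2 where
  t : ℝ
  x : ℝ
  y : ℝ
  u : ℝ
  ut : ℝ
  ux : ℝ
  uy : ℝ
  utt : ℝ
  utx : ℝ
  uty : ℝ
  uxx : ℝ
  uxy : ℝ
  uyy : ℝ

/-- The 2-jet of the function `f` at the point `p`. -/
def jet2 (f : Base → ℝ) (p : Base) : Jet2 where
  t := p.1
  x := p.2.1
  y := p.2.2
  u := f p
  ut := dt f p
  ux := dx f p
  uy := dy f p
  utt := dt (dt f) p
  utx := dt (dx f) p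
  uty := dt (dy f) p
  uxx := dx (dx f) p
  uxy := dx (dy f) p
  uyy := dy (dy f) p

/-! ### Point transformations and their action on equations -/

/-- A point transformation of a space `E` (an element of the pseudogroup of local
diffeomorphisms): a `C^∞` diffeomorphism from a nonempty open subset of `E` onto an open subset. -/
def IsPointTransformation {E : Type*} [NormedAddCommGroup E] [NormedSpace ℝ E]
    (Φ : OpenPartialHomeomorph E E) : Prop :=
  Φ.source.Nonempty ∧ ContDiffOn ℝ ∞ Φ Φ.source ∧ ContDiffOn ℝ ∞ Φ.symm Φ.target

/-- Near `(p, f p)`, the transformation `Φ` maps the graph of the smooth function `f` to the graph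
of the smooth function `g`, with `(p, f p)` going to `(q, g q)`; that is, the second prolongation
of `Φ` maps the jet of `f` at `p` to the jet of `g` at `q`. -/
def MapsGraphAt (Φ : OpenPartialHomeomorph Vars Vars) (f : Base → ℝ) (p : Base)
    (g : Base → ℝ) (q : Base) : Prop :=
  ContDiffAt ℝ ∞ f p ∧ ContDiffAt ℝ ∞ g q ∧ (p, f p) ∈ Φ.source ∧ Φ (p, f p) = (q, g q) ∧
    ∀ᶠ p' in 𝓝 p, (Φ (p', f p')).2 = g (Φ (p', f p')).1

/-- `Φ_* L = L'` for two second-order equations `L`, `L'`, considered as subsets of the jet space: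
the second prolongation of `Φ` matches, wherever it is defined, the points of `L` with those of
`L'`. -/
def PushesForward (Φ : OpenPartialHomeomorph Vars Vars) (L L' : Set Jet2) : Prop :=
  ∀ (f : Base → ℝ) (p : Base) (g : Base → ℝ) (q : Base), MapsGraphAt Φ f p g q →
    (jet2 f p ∈ L ↔ jet2 g q ∈ L')

/-! ### Classes of equations, their equivalence groups and groupoids -/

/-- A class of second-order equations, parameterized by the tuple `θ : Θ` of constant arbitrary
elements. -/
abbrev EqClass (Θ : Type*) : Type _ := Θ → Set Jet2

/-- Triples `(θ, Φ, θ')`. -/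
structure Arrow (Θ : Type*) where
  src : Θ
  map : OpenPartialHomeomorph Vars Vars
  tgt : Θ

/-- The equivalence groupoid: the set of all admissible transformations `(θ, Φ, θ')`,
`Φ_* L_θ = L_θ'`. -/
def equivalenceGroupoid {Θ : Type*} (L : EqClass Θ) : Set (Arrow Θ) :=
  {T | IsPointTransformation T.map ∧ PushesForward T.map (L T.src) (L T.tgt)}

/-- The fundamental groupoid: the union of all vertex groups of the equivalence groupoid. -/
def fundamentalGroupoid {Θ : Type*} (L : EqClass Θ) : Set (Arrow Θ) :=
  {T | T ∈ equivalenceGroupoid L ∧ T.src = T.tgt}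

/-- `Φ = π_* Ψ`: the transformation `Ψ` of the joint space of variables and arbitrary elements,
defined for all values of the arbitrary elements, is projectable to the space of variables, with
projection `Φ`. -/
def IsProjection {Θ : Type*} [TopologicalSpace Θ]
    (Ψ : OpenPartialHomeomorph (Vars × Θ) (Vars × Θ))
    (Φ : OpenPartialHomeomorph Vars Vars) : Prop :=
  Ψ.source = Φ.source ×ˢ univ ∧ ∀ w ∈ Ψ.source, (Ψ w).1 = Φ w.1

/-- The action groupoid of a set (pseudogroup) `H` of transformations of the joint space: the
triples `(θ, π_* Ψ, Ψ θ)` with `Ψ ∈ H`. -/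
def actionGroupoid {Θ : Type*} [TopologicalSpace Θ]
    (H : Set (OpenPartialHomeomorph (Vars × Θ) (Vars × Θ))) : Set (Arrow Θ) :=
  {T | ∃ Ψ ∈ H, IsProjection Ψ T.map ∧ ∀ z ∈ T.map.source, Ψ (z, T.src) = (T.map z, T.tgt)}

/-- The (usual) equivalence (pseudo)group of a class: the point transformations of the joint space
of variables and arbitrary elements that are projectable to the space of variables and map every
equation of the class to an equation of the class. -/
def equivalenceGroup {Θ : Type*} [NormedAddCommGroup Θ] [NormedSpace ℝ Θ] (L : EqClass Θ) :
    Set (OpenPartialHomeomorph (Vars × Θ) (Vars × Θ)) :=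
  {Ψ | IsPointTransformation Ψ ∧ ∃ Φ, IsProjection Ψ Φ ∧ ∀ θ : Θ, ∃ θ' : Θ,
    (∀ z ∈ Φ.source, (Ψ (z, θ)).2 = θ') ∧ (⟨θ, Φ, θ'⟩ : Arrow Θ) ∈ equivalenceGroupoid L}

/-- The Frobenius product `A ⋆ B`: all compositions of an element of `A` followed by an element of
`B`, over all composable pairs. Transformations are identified if they have the same domain and
coincide there (`≈`). -/
def frobeniusProduct {Θ : Type*} (A B : Set (Arrow Θ)) : Set (Arrow Θ) :=
  {T | ∃ T₁ ∈ A, ∃ T₂ ∈ B, T₁.tgt = T₂.src ∧ (T₁.map.trans T₂.map).source.Nonempty ∧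
    T.src = T₁.src ∧ T.tgt = T₂.tgt ∧ T.map ≈ T₁.map.trans T₂.map}

/-- The (pseudo)group generated by a single transformation. -/
inductive Generated {E : Type*} [TopologicalSpace E] (J : OpenPartialHomeomorph E E) :
    OpenPartialHomeomorph E E → Prop
  | base : Generated J J
  | one : Generated J (OpenPartialHomeomorph.refl E)
  | inv {Ψ : OpenPartialHomeomorph E E} : Generated J Ψ → Generated J Ψ.symm
  | comp {Ψ Ψ' : OpenPartialHomeomorph E E} :
      Generated J Ψ → Generated J Ψ' → Generated J (Ψ.trans Ψ')
  | congr {Ψ Ψ' : OpenPartialHomeomorph E E} : Generated J Ψ → Ψ ≈ Ψ' → Generated J Ψ'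

def generatedGroup {E : Type*} [TopologicalSpace E] (J : OpenPartialHomeomorph E E) :
    Set (OpenPartialHomeomorph E E) := {Ψ | Generated J Ψ}

/-- A class is semi-normalized with respect to a subgroup `H` of its equivalence group if its
equivalence groupoid is the Frobenius product of the action groupoid of `H` and the fundamental
groupoid, in either order of the factors. -/
def IsSemiNormalizedWrt {Θ : Type*} [NormedAddCommGroup Θ] [NormedSpace ℝ Θ] (L : EqClass Θ)
    (H : Set (OpenPartialHomeomorph (Vars × Θ) (Vars × Θ))) : Prop :=
  H ⊆ equivalenceGroup L ∧
    equivalenceGroupoid L = frobeniusProduct (actionGroupoid H) (fundamentalGroupoid L) ∧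
    equivalenceGroupoid L = frobeniusProduct (fundamentalGroupoid L) (actionGroupoid H)

/-- `Ψ` is a restriction of `Ψ'` to a smaller domain. -/
def IsRestriction {E : Type*} [TopologicalSpace E] (Ψ Ψ' : OpenPartialHomeomorph E E) : Prop :=
  Ψ.source ⊆ Ψ'.source ∧ EqOn Ψ Ψ' Ψ.source

/-- `Ψ` is a discrete equivalence transformation of the class: it is an equivalence transformation
that cannot be joined with the identity, even after restricting the domains, by a continuous
family of equivalence transformations (the domains in the family are allowed to vary). -/
def IsDiscreteEquivalence {Θ : Type*} [NormedAddCommGroup Θ] [NormedSpace ℝ Θ] (L : EqClass Θ)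
    (Ψ : OpenPartialHomeomorph (Vars × Θ) (Vars × Θ)) : Prop :=
  Ψ ∈ equivalenceGroup L ∧
    ¬ ∃ γ : unitInterval → OpenPartialHomeomorph (Vars × Θ) (Vars × Θ),
      (∀ s, γ s ∈ equivalenceGroup L) ∧
      IsOpen {q : unitInterval × (Vars × Θ) | q.2 ∈ (γ q.1).source} ∧
      ContinuousOn (fun q : unitInterval × (Vars × Θ) => γ q.1 q.2)
        {q : unitInterval × (Vars × Θ) | q.2 ∈ (γ q.1).source} ∧
      IsRestriction (γ 0) (OpenPartialHomeomorph.refl (Vars × Θ)) ∧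
      IsRestriction (γ 1) Ψ

/-! ### The two classes and the distinguished transformations -/

/-- The class `F`: `u_t + x u_y = |x - α|^β u_xx`, with `θ = (α, β)`, on `x ≠ α`. -/
def classF : EqClass (ℝ × ℝ) := fun θ =>
  {j | j.x ≠ θ.1 ∧ j.ut + j.x * j.uy = |j.x - θ.1| ^ θ.2 * j.uxx}

/-- The gauged class `F'`: `u_t + x u_y = |x|^β u_xx`, with `θ = β`, on `x ≠ 0`. -/
def classF' : EqClass ℝ := fun β =>
  {j | j.x ≠ 0 ∧ j.ut + j.x * j.uy = |j.x| ^ β * j.uxx}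

/-- The projection of `S(c)` to the variables: `(t, x, y, u) ↦ (t, x + c, y + c t, u)`. -/
def shiftVars (c : ℝ) : OpenPartialHomeomorph Vars Vars :=
  Homeomorph.toOpenPartialHomeomorph
    { toFun := fun z => ((z.1.1, z.1.2.1 + c, z.1.2.2 + c * z.1.1), z.2)
      invFun := fun z => ((z.1.1, z.1.2.1 - c, z.1.2.2 - c * z.1.1), z.2)
      left_inv := by
        rintro ⟨⟨t, x, y⟩, u⟩
        simp
      right_inv := by
        rintro ⟨⟨t, x, y⟩, u⟩
        simp
      continuous_toFun := by fun_prop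
      continuous_invFun := by fun_prop }

/-- `S(c)`: `(t, x, y, u, α, β) ↦ (t, x + c, y + c t, u, α + c, β)`. -/
def shift (c : ℝ) : OpenPartialHomeomorph (Vars × (ℝ × ℝ)) (Vars × (ℝ × ℝ)) :=
  Homeomorph.toOpenPartialHomeomorph
    { toFun := fun w =>
        (((w.1.1.1, w.1.1.2.1 + c, w.1.1.2.2 + c * w.1.1.1), w.1.2), (w.2.1 + c, w.2.2))
      invFun := fun w =>
        (((w.1.1.1, w.1.1.2.1 - c, w.1.1.2.2 - c * w.1.1.1), w.1.2), (w.2.1 - c, w.2.2))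
      left_inv := by
        rintro ⟨⟨⟨t, x, y⟩, u⟩, a, b⟩
        simp
      right_inv := by
        rintro ⟨⟨⟨t, x, y⟩, u⟩, a, b⟩
        simp
      continuous_toFun := by fun_prop
      continuous_invFun := by fun_prop }

/-- The triple `((α, β), π_* S(-α), (0, β))`. -/
def gaugeArrow (θ : ℝ × ℝ) : Arrow (ℝ × ℝ) := ⟨θ, shiftVars (-θ.1), (0, θ.2)⟩

/-- The map underlying `J'`: `(t, x, y, u, β) ↦ (y sgn x, 1/x, t sgn x, u/x, 5 - β)`. -/
def inversionFun (w : Vars × ℝ) : Vars × ℝ :=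
  (((w.1.1.2.2 * Real.sign w.1.1.2.1, 1 / w.1.1.2.1, w.1.1.1 * Real.sign w.1.1.2.1),
    w.1.2 / w.1.1.2.1), 5 - w.2)

theorem inversionFun_invol (w : Vars × ℝ) (hw : w.1.1.2.1 ≠ 0) :
    inversionFun (inversionFun w) = w := by
  obtain ⟨⟨⟨t, x, y⟩, u⟩, b⟩ := w
  have hx : x ≠ 0 := hw
  rcases lt_or_gt_of_ne hx with h | h
  · simp [inversionFun, Real.sign_of_neg h, Real.sign_of_neg (inv_lt_zero.2 h), hx]
  · simp [inversionFun, Real.sign_of_pos h, Real.sign_of_pos (inv_pos.2 h), hx]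

theorem isOpen_x_ne_zero : IsOpen {w : Vars × ℝ | w.1.1.2.1 ≠ 0} :=
  isOpen_ne_fun (by fun_prop) continuous_const

theorem continuousOn_inversionFun :
    ContinuousOn inversionFun {w : Vars × ℝ | w.1.1.2.1 ≠ 0} := by
  have hx : ContinuousOn (fun w : Vars × ℝ => w.1.1.2.1) {w : Vars × ℝ | w.1.1.2.1 ≠ 0} := by
    fun_prop
  have hs : ContinuousOn (fun w : Vars × ℝ => Real.sign w.1.1.2.1)
      {w : Vars × ℝ | w.1.1.2.1 ≠ 0} := by
    have h : ContinuousOn (fun w : Vars × ℝ => w.1.1.2.1 / |w.1.1.2.1|)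
        {w : Vars × ℝ | w.1.1.2.1 ≠ 0} :=
      hx.div (by fun_prop) (fun w hw => abs_ne_zero.2 hw)
    refine h.congr ?_
    intro w hw
    have hw' : w.1.1.2.1 ≠ 0 := hw
    rcases lt_or_gt_of_ne hw' with h | h
    · simp only [Real.sign_of_neg h, abs_of_neg h]
      field_simp
    · simp only [Real.sign_of_pos h, abs_of_pos h]
      field_simp
  unfold inversionFun
  refine ContinuousOn.prodMk (ContinuousOn.prodMk (ContinuousOn.prodMk ?_
    (ContinuousOn.prodMk ?_ ?_)) ?_) ?_
  · exact ContinuousOn.mul (by fun_prop) hs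
  · exact ContinuousOn.div continuousOn_const hx (fun w hw => hw)
  · exact ContinuousOn.mul (by fun_prop) hs
  · exact ContinuousOn.div (by fun_prop) hx (fun w hw => hw)
  · fun_prop

theorem inversionFun_mapsTo (w : Vars × ℝ) (hw : w.1.1.2.1 ≠ 0) :
    (inversionFun w).1.1.2.1 ≠ 0 := one_div_ne_zero hw

/-- The transformation `J'`, with the domain `x ≠ 0`. -/
def inversion : OpenPartialHomeomorph (Vars × ℝ) (Vars × ℝ) where
  toFun := inversionFun
  invFun := inversionFun
  source := {w | w.1.1.2.1 ≠ 0}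
  target := {w | w.1.1.2.1 ≠ 0}
  map_source' := inversionFun_mapsTo
  map_target' := inversionFun_mapsTo
  left_inv' := inversionFun_invol
  right_inv' := inversionFun_invol
  open_source := isOpen_x_ne_zero
  open_target := isOpen_x_ne_zero
  continuousOn_toFun := continuousOn_inversionFun
  continuousOn_invFun := continuousOn_inversionFun

end KolmogorovBackward

end

open KolmogorovBackward

open KolmogorovBackward

namespace KolmogorovBackward

open Filter

/-! ### Calculus preliminaries -/

/-! Write `T`, `X`, `Y`, `U` for the components of an admissible `Φ` from exponent `β` to `β'`.
Everything rests on testing `Φ` against 2-jets of solutions. At a point with `x ≠ 0` the equation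
fixes `u_xx` through `u_t + x u_y` and leaves the other second derivatives free.

Perturbing the free second derivatives cannot affect the transformed equation, so the direction
carried to `∂_X` is parallel to `∂_x` (`transversal_direction`). Varying `u_x` then gives `T_x = T_u
= Y_x = Y_u = 0`. Perturbing `u_t`, `u_y`, with `u_xx` adjusted to compensate, gives `X·DT = DY` and
`|x|^β (X_x + u_x X_u)² = |X|^β' DT` with `D = ∂_t + x∂_y` (`transversal_relations`). The second
relation is polynomial in `u_x`, hence `X_u = 0` (`determining_equations`).

On a line parallel to the `x`-axis this reads `X = (A + Bx)/(C + Ex)` with constant coefficients and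
`Δ = BC − AE ≠ 0`, while `|x|^β Δ² = |X|^β' (C + Ex)^5`. The logarithmic derivative is a polynomial
identity of degree two in `x` (`exponent_relations`), and its coefficients leave only `β' = β` or
`β' = 5 − β`; if `β' ≠ β`, the domain also misses `x = 0` (`tgt_eq_of_admissible`).

Semi-normalization follows: an arrow with `β' ≠ β` becomes a vertex-group arrow after composition
with the inversion, without loss of domain. Discreteness follows because the image of the exponent 0
along a continuous family stays in `{0, 5}`. The shifts and the inversion themselves are checked by
direct differentiation. -/

theorem fderiv_fderiv_comp_apply {E F G : Type*} [NormedAddCommGroup E] [NormedSpace ℝ E]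
    [NormedAddCommGroup F] [NormedSpace ℝ F] [NormedAddCommGroup G] [NormedSpace ℝ G]
    {g : F → G} {f : E → F} {x : E} (hg : ContDiffAt ℝ ∞ g (f x)) (hf : ContDiffAt ℝ ∞ f x)
    (v w : E) :
    fderiv ℝ (fderiv ℝ (fun y => g (f y))) x v w =
      fderiv ℝ (fderiv ℝ g) (f x) (fderiv ℝ f x v) (fderiv ℝ f x w) +
        fderiv ℝ g (f x) (fderiv ℝ (fderiv ℝ f) x v w) := by
  have h1 : fderiv ℝ (fun y => g (f y)) =ᶠ[𝓝 x]
      fun y => (fderiv ℝ g (f y)).comp (fderiv ℝ f y) := by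
    have a1 : ∀ᶠ y in 𝓝 x, DifferentiableAt ℝ g (f y) :=
      hf.continuousAt.eventually (((hg.of_le (m := 1) (by norm_cast)).eventually
        (by simp)).mono fun y hy => hy.differentiableAt (by simp))
    have a2 : ∀ᶠ y in 𝓝 x, DifferentiableAt ℝ f y :=
      ((hf.of_le (m := 1) (by norm_cast)).eventually (by simp)).mono
        fun y hy => hy.differentiableAt (by simp)
    filter_upwards [a1, a2] with y h1 h2
    exact fderiv_fun_comp y h1 h2
  have hg' : HasFDerivAt (fderiv ℝ g) (fderiv ℝ (fderiv ℝ g) (f x)) (f x) :=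
    ((hg.fderiv_right (m := 1) (by norm_cast)).differentiableAt (by simp)).hasFDerivAt
  have hf' : HasFDerivAt (fderiv ℝ f) (fderiv ℝ (fderiv ℝ f) x) x :=
    ((hf.fderiv_right (m := 1) (by norm_cast)).differentiableAt (by simp)).hasFDerivAt
  have hf1 : HasFDerivAt f (fderiv ℝ f x) x := (hf.differentiableAt (by simp)).hasFDerivAt
  have h2 := (hg'.comp x hf1).clm_comp hf'
  rw [h1.fderiv_eq]
  rw [HasFDerivAt.fderiv (f := fun y => (fderiv ℝ g (f y)).comp (fderiv ℝ f y)) h2]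
  simp [add_comm]

theorem exists_local_inverse {E : Type*} [NormedAddCommGroup E] [NormedSpace ℝ E]
    [FiniteDimensional ℝ E] {φ : E → E} {p : E} (hφ : ContDiffAt ℝ ∞ φ p)
    (hinj : Function.Injective (fderiv ℝ φ p)) :
    ∃ ψ : E → E, ContDiffAt ℝ ∞ ψ (φ p) ∧ (∀ᶠ p' in 𝓝 p, ψ (φ p') = p') ∧
      ∀ᶠ q' in 𝓝 (φ p), φ (ψ q') = q' := by
  have : CompleteSpace E := FiniteDimensional.complete ℝ E
  let e : E ≃L[ℝ] E := (LinearEquiv.ofInjectiveEndo (fderiv ℝ φ p : E →ₗ[ℝ] E)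
    hinj).toContinuousLinearEquiv
  have he : HasFDerivAt φ (e : E →L[ℝ] E) p := by
    have : (e : E →L[ℝ] E) = fderiv ℝ φ p := by ext v; rfl
    rw [this]
    exact (hφ.differentiableAt (by simp)).hasFDerivAt
  have hs : HasStrictFDerivAt φ (e : E →L[ℝ] E) p := hφ.hasStrictFDerivAt' he (by simp)
  exact ⟨hφ.localInverse he (by simp), hφ.to_localInverse he (by simp),
    hs.eventually_left_inverse, hs.eventually_right_inverse⟩

/-! ### Prolongation of point transformations -/

theorem IsPointTransformation.contDiffAt {E : Type*} [NormedAddCommGroup E] [NormedSpace ℝ E]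
    {Φ : OpenPartialHomeomorph E E} (hΦ : IsPointTransformation Φ) {z : E} (hz : z ∈ Φ.source) :
    ContDiffAt ℝ ∞ Φ z :=
  hΦ.2.1.contDiffAt (Φ.open_source.mem_nhds hz)

theorem IsPointTransformation.symm {E : Type*} [NormedAddCommGroup E] [NormedSpace ℝ E]
    {Φ : OpenPartialHomeomorph E E} (hΦ : IsPointTransformation Φ) :
    IsPointTransformation Φ.symm :=
  ⟨hΦ.1.elim fun z hz => ⟨Φ z, Φ.map_source hz⟩, hΦ.2.2, by simpa using hΦ.2.1⟩

theorem IsPointTransformation.trans {E : Type*} [NormedAddCommGroup E] [NormedSpace ℝ E]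
    {Φ Φ' : OpenPartialHomeomorph E E} (hΦ : IsPointTransformation Φ)
    (hΦ' : IsPointTransformation Φ') (hne : (Φ.trans Φ').source.Nonempty) :
    IsPointTransformation (Φ.trans Φ') := by
  refine ⟨hne, ?_, ?_⟩
  · rw [Φ.trans_source]
    exact hΦ'.2.1.comp (hΦ.2.1.mono inter_subset_left) fun z hz => hz.2
  · rw [Φ.trans_target]
    exact hΦ.2.2.comp (hΦ'.2.2.mono inter_subset_left) fun z hz => hz.2

theorem IsPointTransformation.congr {E : Type*} [NormedAddCommGroup E] [NormedSpace ℝ E]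
    {Φ Φ' : OpenPartialHomeomorph E E} (hΦ : IsPointTransformation Φ) (h : Φ ≈ Φ') :
    IsPointTransformation Φ' := by
  have h' : Φ.symm ≈ Φ'.symm := OpenPartialHomeomorph.EqOnSource.symm' h
  refine ⟨h.1 ▸ hΦ.1, ?_, ?_⟩
  · rw [← h.1]; exact hΦ.2.1.congr fun z hz => (h.2 hz).symm
  · have ht : Φ.target = Φ'.target := h'.1
    rw [← ht]; exact hΦ.2.2.congr fun z hz => (h'.2 hz).symm

theorem IsPointTransformation.bijective_fderiv {E : Type*} [NormedAddCommGroup E]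
    [NormedSpace ℝ E] {Φ : OpenPartialHomeomorph E E} (hΦ : IsPointTransformation Φ) {z : E}
    (hz : z ∈ Φ.source) : Function.Bijective (fderiv ℝ Φ z) := by
  have key : ∀ {Ψ : OpenPartialHomeomorph E E}, IsPointTransformation Ψ → ∀ {z : E},
      z ∈ Ψ.source → (fderiv ℝ Ψ.symm (Ψ z)).comp (fderiv ℝ Ψ z) = ContinuousLinearMap.id ℝ E := by
    intro Ψ hΨ z hz
    have h1 : HasFDerivAt Ψ (fderiv ℝ Ψ z) z :=
      ((hΨ.contDiffAt hz).differentiableAt (by simp)).hasFDerivAt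
    have h2 : HasFDerivAt Ψ.symm (fderiv ℝ Ψ.symm (Ψ z)) (Ψ z) :=
      ((hΨ.symm.contDiffAt (Ψ.map_source hz)).differentiableAt (by simp)).hasFDerivAt
    have h3 : HasFDerivAt (fun y => Ψ.symm (Ψ y)) (ContinuousLinearMap.id ℝ E) z :=
      (hasFDerivAt_id z).congr_of_eventuallyEq (Ψ.eventually_left_inverse hz)
    exact (h2.comp z h1).unique h3
  have k1 := key hΦ hz
  have k2 := key hΦ.symm (Φ.map_source hz)
  rw [Φ.left_inv hz, OpenPartialHomeomorph.symm_symm] at k2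
  refine Function.bijective_iff_has_inverse.2 ⟨fderiv ℝ Φ.symm (Φ z), fun v => ?_, fun v => ?_⟩
  · exact congrArg (fun L : E →L[ℝ] E => L v) k1
  · exact congrArg (fun L : E →L[ℝ] E => L v) k2

section Graph

variable {Φ : OpenPartialHomeomorph Vars Vars} {f g : Base → ℝ} {p q : Base}

theorem contDiffAt_graph (hf : ContDiffAt ℝ ∞ f p) :
    ContDiffAt ℝ ∞ (fun p' => ((p', f p') : Vars)) p :=
  contDiffAt_id.prodMk hf

theorem hasFDerivAt_graph (hf : ContDiffAt ℝ ∞ f p) :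
    HasFDerivAt (fun p' => ((p', f p') : Vars))
      ((ContinuousLinearMap.id ℝ Base).prod (fderiv ℝ f p)) p :=
  (hasFDerivAt_id p).prodMk (hf.differentiableAt (by simp)).hasFDerivAt

theorem fderiv_graph_apply (hf : ContDiffAt ℝ ∞ f p) (v : Base) :
    fderiv ℝ (fun p' => ((p', f p') : Vars)) p v = (v, fderiv ℝ f p v) := by
  rw [(hasFDerivAt_graph hf).fderiv]; rfl

theorem fderiv_fderiv_graph_apply (hf : ContDiffAt ℝ ∞ f p) (v w : Base) :
    fderiv ℝ (fderiv ℝ (fun p' => ((p', f p') : Vars))) p v w =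
      (0, fderiv ℝ (fderiv ℝ f) p v w) := by
  have h : fderiv ℝ (fun p' => ((p', f p') : Vars)) =ᶠ[𝓝 p]
      fun y => (ContinuousLinearMap.id ℝ Base).prod (fderiv ℝ f y) := by
    filter_upwards [(hf.of_le (m := 1) (by norm_cast)).eventually (by simp)] with y hy
    exact ((hasFDerivAt_id y).prodMk (hy.differentiableAt (by simp)).hasFDerivAt).fderiv
  have hf' : HasFDerivAt (fderiv ℝ f) (fderiv ℝ (fderiv ℝ f) p) p :=
    ((hf.fderiv_right (m := 1) (by norm_cast)).differentiableAt (by simp)).hasFDerivAt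
  have h2 : HasFDerivAt (fun y => (ContinuousLinearMap.id ℝ Base).prod (fderiv ℝ f y))
      (((ContinuousLinearMap.inr ℝ Base ℝ).postcomp Base).comp (fderiv ℝ (fderiv ℝ f) p)) p := by
    have h3 := (((ContinuousLinearMap.inr ℝ Base ℝ).postcomp Base).hasFDerivAt.comp p hf').const_add
      ((ContinuousLinearMap.inl ℝ Base ℝ))
    refine h3.congr_of_eventuallyEq (Eventually.of_forall fun y => ?_)
    ext <;> simp
  rw [h.fderiv_eq, h2.fderiv]
  simp

theorem contDiffAt_comp_graph (hΦ : IsPointTransformation Φ) (hz : (p, f p) ∈ Φ.source)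
    (hf : ContDiffAt ℝ ∞ f p) : ContDiffAt ℝ ∞ (fun p' => Φ (p', f p')) p :=
  (hΦ.contDiffAt hz).comp p (contDiffAt_graph hf)

theorem fderiv_comp_graph (hΦ : IsPointTransformation Φ) (hz : (p, f p) ∈ Φ.source)
    (hf : ContDiffAt ℝ ∞ f p) (v : Base) :
    fderiv ℝ (fun p' => Φ (p', f p')) p v = fderiv ℝ Φ (p, f p) (v, fderiv ℝ f p v) := by
  have h := ((hΦ.contDiffAt hz).differentiableAt (by simp)).hasFDerivAt.comp p
    (hasFDerivAt_graph hf)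
  exact congrArg (fun L : Base →L[ℝ] Vars => L v) h.fderiv

theorem fderiv_fst_comp_graph (hΦ : IsPointTransformation Φ) (hz : (p, f p) ∈ Φ.source)
    (hf : ContDiffAt ℝ ∞ f p) (v : Base) :
    fderiv ℝ (fun p' => (Φ (p', f p')).1) p v =
      (fderiv ℝ Φ (p, f p) (v, fderiv ℝ f p v)).1 := by
  rw [← fderiv_comp_graph hΦ hz hf]
  have h := ((contDiffAt_comp_graph hΦ hz hf).differentiableAt (by simp)).hasFDerivAt.fst
  rw [h.fderiv]; rfl

theorem fderiv_snd_comp_graph (hΦ : IsPointTransformation Φ) (hz : (p, f p) ∈ Φ.source)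
    (hf : ContDiffAt ℝ ∞ f p) (v : Base) :
    fderiv ℝ (fun p' => (Φ (p', f p')).2) p v =
      (fderiv ℝ Φ (p, f p) (v, fderiv ℝ f p v)).2 := by
  rw [← fderiv_comp_graph hΦ hz hf]
  have h := ((contDiffAt_comp_graph hΦ hz hf).differentiableAt (by simp)).hasFDerivAt.snd
  rw [h.fderiv]; rfl

/-- The first-order prolongation formula. -/
theorem MapsGraphAt.fderiv_eq (hΦ : IsPointTransformation Φ) (h : MapsGraphAt Φ f p g q)
    (v : Base) :
    (fderiv ℝ Φ (p, f p) (v, fderiv ℝ f p v)).2 =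
      fderiv ℝ g q (fderiv ℝ Φ (p, f p) (v, fderiv ℝ f p v)).1 := by
  obtain ⟨hf, hg, hz, hq, he⟩ := h
  have hφ := (contDiffAt_comp_graph hΦ hz hf).fst
  have hg' : ContDiffAt ℝ ∞ g (Φ (p, f p)).1 := by rw [hq]; exact hg
  have e1 := Filter.EventuallyEq.fderiv_eq (𝕜 := ℝ) (show (fun p' => (Φ (p', f p')).2) =ᶠ[𝓝 p]
    fun p' => g (Φ (p', f p')).1 from he)
  have e2 := congrArg (fun L : Base →L[ℝ] ℝ => L v) e1
  rw [fderiv_snd_comp_graph hΦ hz hf, fderiv_fun_comp p (hg'.differentiableAt (by simp))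
    (hφ.differentiableAt (by simp))] at e2
  rw [e2, ContinuousLinearMap.comp_apply, fderiv_fst_comp_graph hΦ hz hf, hq]

theorem fderiv_fderiv_clm_comp {E F G : Type*} [NormedAddCommGroup E] [NormedSpace ℝ E]
    [NormedAddCommGroup F] [NormedSpace ℝ F] [NormedAddCommGroup G] [NormedSpace ℝ G]
    (L : F →L[ℝ] G) {f : E → F} {x : E} (hf : ContDiffAt ℝ ∞ f x) (v w : E) :
    fderiv ℝ (fderiv ℝ (fun y => L (f y))) x v w = L (fderiv ℝ (fderiv ℝ f) x v w) := by
  have h := fderiv_fderiv_comp_apply (g := fun y => L y) L.contDiff.contDiffAt hf v w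
  have h0 : fderiv ℝ (fun y => L y) = fun _ => L := by ext1 y; exact L.fderiv
  rw [h, h0]
  simp

/-- The second-order prolongation formula in a single direction. -/
theorem MapsGraphAt.fderiv_fderiv_eq (hΦ : IsPointTransformation Φ) (h : MapsGraphAt Φ f p g q)
    (w : Base) {a : Vars} (ha : fderiv ℝ Φ (p, f p) (w, fderiv ℝ f p w) = a)
    {S : Vars} (hS : S = fderiv ℝ (fderiv ℝ Φ) (p, f p) (w, fderiv ℝ f p w) (w, fderiv ℝ f p w) +
      fderiv ℝ Φ (p, f p) (0, fderiv ℝ (fderiv ℝ f) p w w)) :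
    S.2 = fderiv ℝ (fderiv ℝ g) q a.1 a.1 + fderiv ℝ g q S.1 := by
  obtain ⟨hf, hg, hz, hq, he⟩ := h
  have hc := contDiffAt_comp_graph hΦ hz hf
  have hg' : ContDiffAt ℝ ∞ g (Φ (p, f p)).1 := by rw [hq]; exact hg
  have hS' : fderiv ℝ (fderiv ℝ (fun p' => Φ (p', f p'))) p w w = S := by
    rw [fderiv_fderiv_comp_apply (f := fun p' => ((p', f p') : Vars)) (hΦ.contDiffAt hz)
        (contDiffAt_graph hf),
      fderiv_graph_apply hf, fderiv_fderiv_graph_apply hf, hS]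
  have e1 := (Filter.EventuallyEq.fderiv (𝕜 := ℝ) (show (fun p' => (Φ (p', f p')).2) =ᶠ[𝓝 p]
    fun p' => g (Φ (p', f p')).1 from he)).fderiv_eq (𝕜 := ℝ)
  have e2 := congrArg (fun L : Base →L[ℝ] Base →L[ℝ] ℝ => L w w) e1
  rw [fderiv_fderiv_comp_apply (f := fun p' => (Φ (p', f p')).1) hg' hc.fst] at e2
  have e3 := fderiv_fderiv_clm_comp (ContinuousLinearMap.fst ℝ Base ℝ) hc w w
  have e4 := fderiv_fderiv_clm_comp (ContinuousLinearMap.snd ℝ Base ℝ) hc w w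
  simp only [ContinuousLinearMap.coe_fst', ContinuousLinearMap.coe_snd'] at e3 e4
  rw [e3, e4, hS', fderiv_fst_comp_graph hΦ hz hf, ha, hq] at e2
  exact e2

/-- The injectivity hypothesis says that the base part of `Φ` along the graph is a local
diffeomorphism; composing the fibre part with its local inverse gives `g`. -/
theorem exists_mapsGraphAt (hΦ : IsPointTransformation Φ) (hz : (p, f p) ∈ Φ.source)
    (hf : ContDiffAt ℝ ∞ f p)
    (hinj : Function.Injective fun v => (fderiv ℝ Φ (p, f p) (v, fderiv ℝ f p v)).1) :
    ∃ g, MapsGraphAt Φ f p g (Φ (p, f p)).1 := by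
  have hc := contDiffAt_comp_graph hΦ hz hf
  have hinj' : Function.Injective (fderiv ℝ (fun p' => (Φ (p', f p')).1) p) := by
    intro v v' h
    rw [fderiv_fst_comp_graph hΦ hz hf, fderiv_fst_comp_graph hΦ hz hf] at h
    exact hinj h
  obtain ⟨ψ, hψ, hl, -⟩ := exists_local_inverse hc.fst hinj'
  have hψp : ψ (Φ (p, f p)).1 = p := hl.self_of_nhds
  refine ⟨fun q' => (Φ (ψ q', f (ψ q'))).2, hf, ?_, hz, ?_, ?_⟩
  · have hc' : ContDiffAt ℝ ∞ (fun p' => Φ (p', f p')) (ψ (Φ (p, f p)).1) := by rwa [hψp]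
    exact (hc'.comp _ hψ).snd
  · simp only [hψp]
  · filter_upwards [hl] with p' hp'
    simp only [hp']

/-- Transversality need not be assumed: since `g` is differentiable, a tangent vector of the graph
whose image has zero base part also has zero fibre part, hence is zero. The inverse function theorem
then applies. -/
theorem MapsGraphAt.symm (hΦ : IsPointTransformation Φ) (h : MapsGraphAt Φ f p g q) :
    MapsGraphAt Φ.symm g q f p := by
  have h1 := h.fderiv_eq hΦ
  obtain ⟨hf, hg, hz, hq, he⟩ := h
  have hc := contDiffAt_comp_graph hΦ hz hf
  have hinj' : Function.Injective (fderiv ℝ (fun p' => (Φ (p', f p')).1) p) := by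
    rw [injective_iff_map_eq_zero]
    intro v hv
    rw [fderiv_fst_comp_graph hΦ hz hf] at hv
    have h2 := h1 v
    rw [hv, map_zero] at h2
    have h3 : fderiv ℝ Φ (p, f p) (v, fderiv ℝ f p v) = fderiv ℝ Φ (p, f p) 0 := by
      rw [map_zero]; exact Prod.ext hv h2
    exact congrArg Prod.fst ((hΦ.bijective_fderiv hz).1 h3)
  obtain ⟨ψ, hψ, hl, hr⟩ := exists_local_inverse hc.fst hinj'
  have hψp : ψ (Φ (p, f p)).1 = p := hl.self_of_nhds
  rw [hq] at hψ hr hψp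
  simp only at hψ hr hψp
  refine ⟨hg, hf, ?_, ?_, ?_⟩
  · rw [← hq]; exact Φ.map_source hz
  · rw [← hq]; exact Φ.left_inv hz
  · have t1 : Tendsto ψ (𝓝 q) (𝓝 p) := by
      have := hψ.continuousAt.tendsto
      rwa [hψp] at this
    have t2 : ∀ᶠ p' in 𝓝 p, (p', f p') ∈ Φ.source :=
      (contDiffAt_graph hf).continuousAt.eventually (Φ.open_source.mem_nhds hz)
    filter_upwards [hr, t1.eventually he, t1.eventually t2] with q' h3 h4 h5
    rw [h3] at h4
    have h6 : Φ (ψ q', f (ψ q')) = (q', g q') := Prod.ext h3 h4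
    rw [← h6, Φ.left_inv h5]

theorem PushesForward.symm (hΦ : IsPointTransformation Φ) {L L' : Set Jet2}
    (h : PushesForward Φ L L') : PushesForward Φ.symm L' L := fun f p g q hm =>
  (h g q f p (by simpa using hm.symm hΦ.symm)).symm

theorem symm_mem_equivalenceGroupoid {Θ : Type*} {L : EqClass Θ} {θ θ' : Θ}
    (h : (⟨θ, Φ, θ'⟩ : Arrow Θ) ∈ equivalenceGroupoid L) :
    (⟨θ', Φ.symm, θ⟩ : Arrow Θ) ∈ equivalenceGroupoid L :=
  ⟨h.1.symm, h.2.symm h.1⟩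

end Graph

/-! ### The equations in terms of Fréchet derivatives -/

theorem dx_dx_eq {f : Base → ℝ} {p : Base} (hf : ContDiffAt ℝ ∞ f p) :
    dx (dx f) p = fderiv ℝ (fderiv ℝ f) p (0, 1, 0) (0, 1, 0) := by
  have hf' : HasFDerivAt (fderiv ℝ f) (fderiv ℝ (fderiv ℝ f) p) p :=
    ((hf.fderiv_right (m := 1) (by norm_cast)).differentiableAt (by simp)).hasFDerivAt
  have h := hf'.clm_apply (hasFDerivAt_const ((0, 1, 0) : Base) p)
  unfold dx
  rw [h.fderiv]
  simp

theorem dt_add_mul_dy (f : Base → ℝ) (p : Base) (x : ℝ) :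
    dt f p + x * dy f p = fderiv ℝ f p (1, 0, x) := by
  have h : ((1, 0, x) : Base) = (1, 0, 0) + x • (0, 0, 1) := by simp
  rw [h, map_add, map_smul]; rfl

theorem jet2_mem_classF {f : Base → ℝ} {p : Base} (hf : ContDiffAt ℝ ∞ f p) (θ : ℝ × ℝ) :
    jet2 f p ∈ classF θ ↔ p.2.1 ≠ θ.1 ∧ fderiv ℝ f p (1, 0, p.2.1) =
      |p.2.1 - θ.1| ^ θ.2 * fderiv ℝ (fderiv ℝ f) p (0, 1, 0) (0, 1, 0) := by
  rw [← dx_dx_eq hf, ← dt_add_mul_dy]; rfl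

theorem classF_zero (β : ℝ) : classF (0, β) = classF' β := by
  simp [classF, classF']

theorem jet2_mem_classF' {f : Base → ℝ} {p : Base} (hf : ContDiffAt ℝ ∞ f p) (β : ℝ) :
    jet2 f p ∈ classF' β ↔ p.2.1 ≠ 0 ∧ fderiv ℝ f p (1, 0, p.2.1) =
      |p.2.1| ^ β * fderiv ℝ (fderiv ℝ f) p (0, 1, 0) (0, 1, 0) := by
  rw [← classF_zero, jet2_mem_classF hf]; simp

/-- A quadratic polynomial does it. Only diagonal values of the Hessian are controlled, because `Q`
need not be symmetric and the Hessian is its symmetrization. -/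
theorem exists_two_jet (p : Base) (u : ℝ) (ℓ : Base →L[ℝ] ℝ) (Q : Base →L[ℝ] Base →L[ℝ] ℝ) :
    ∃ f : Base → ℝ, ContDiffAt ℝ ∞ f p ∧ f p = u ∧ fderiv ℝ f p = ℓ ∧
      ∀ w, fderiv ℝ (fderiv ℝ f) p w w = Q w w := by
  let f : Base → ℝ := fun p' => u + ℓ (p' - p) + (1 / 2) * Q (p' - p) (p' - p)
  let R : Base → (Base →L[ℝ] ℝ) := fun p' => ℓ + (1 / 2 : ℝ) • (Q (p' - p) + Q.flip (p' - p))
  have h1 : ∀ p', HasFDerivAt f (R p') p' := by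
    intro p'
    have hs : HasFDerivAt (fun y : Base => y - p) (ContinuousLinearMap.id ℝ Base) p' :=
      (hasFDerivAt_id p').sub_const p
    have h := ((ℓ.hasFDerivAt.comp p' hs).const_add u).add
      (((Q.hasFDerivAt.comp p' hs).clm_apply hs).const_mul (1 / 2 : ℝ))
    refine h.congr_fderiv ?_
    ext <;> simp [R]
  have h1' : fderiv ℝ f = R := funext fun p' => (h1 p').fderiv
  have h2 : HasFDerivAt R ((1 / 2 : ℝ) • (Q + Q.flip)) p := by
    have hs : HasFDerivAt (fun y : Base => y - p) (ContinuousLinearMap.id ℝ Base) p :=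
      (hasFDerivAt_id p).sub_const p
    exact ((((Q.hasFDerivAt.comp p hs).add (Q.flip.hasFDerivAt.comp p hs)).const_smul
      (1 / 2 : ℝ)).const_add ℓ).congr_fderiv (by ext <;> simp)
  refine ⟨f, ?_, by simp [f], by rw [h1']; simp [R], fun w => ?_⟩
  · have : ContDiff ℝ ∞ f := by fun_prop
    exact this.contDiffAt
  · rw [h1', h2.fderiv]
    simp; ring

/-! ### Consequences of admissibility at a point -/

/-- The graph with tangent space `{(v, ℓ v)}` at `z` is mapped by `Φ` to a graph. -/
def IsTransversal (Φ : OpenPartialHomeomorph Vars Vars) (z : Vars) (ℓ : Base →L[ℝ] ℝ) : Prop :=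
  Function.Injective fun v => (fderiv ℝ Φ z (v, ℓ v)).1

section Point

variable {Φ : OpenPartialHomeomorph Vars Vars} {β β' : ℝ} {z : Vars}

/-- The prolongation formulas reduced to what the equation sees. Here `m` is the gradient of the
image graph, `w` the direction carried to `∂_X`, and `S.2 - m S.1` the second `X`-derivative of the
image. The 1-jet `ℓ` and the Hessian `Q` remain free parameters for later perturbations. -/
theorem admissible_relation (hT : (⟨β, Φ, β'⟩ : Arrow ℝ) ∈ equivalenceGroupoid classF')
    (hz : z ∈ Φ.source) (hx : z.1.2.1 ≠ 0) {ℓ : Base →L[ℝ] ℝ} (hℓ : IsTransversal Φ z ℓ)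
    {Q : Base →L[ℝ] Base →L[ℝ] ℝ}
    (hQ : ℓ (1, 0, z.1.2.1) = |z.1.2.1| ^ β * Q (0, 1, 0) (0, 1, 0)) :
    (Φ z).1.2.1 ≠ 0 ∧ ∃ m : Base →L[ℝ] ℝ,
      (∀ v, (fderiv ℝ Φ z (v, ℓ v)).2 = m (fderiv ℝ Φ z (v, ℓ v)).1) ∧
      ∀ w, (fderiv ℝ Φ z (w, ℓ w)).1 = (0, 1, 0) → ∀ S : Vars,
        S = fderiv ℝ (fderiv ℝ Φ) z (w, ℓ w) (w, ℓ w) + fderiv ℝ Φ z (0, Q w w) →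
        m (1, 0, (Φ z).1.2.1) = |(Φ z).1.2.1| ^ β' * (S.2 - m S.1) := by
  obtain ⟨hΦ, hP⟩ := hT
  obtain ⟨f, hf, hfu, rfl, hfQ⟩ := exists_two_jet z.1 z.2 ℓ Q
  have hzf : (z.1, f z.1) = z := Prod.ext rfl hfu
  obtain ⟨g, hg⟩ := exists_mapsGraphAt (p := z.1) (f := f) hΦ (by rwa [hzf]) hf
    (by rw [hzf]; exact hℓ)
  have hL : jet2 f z.1 ∈ classF' β := by
    rw [jet2_mem_classF' hf, hfQ]
    exact ⟨hx, hQ⟩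
  have hL' := (hP f z.1 g _ hg).1 hL
  have h1 := hg.fderiv_eq hΦ
  have h2 := fun w => hg.fderiv_fderiv_eq hΦ w rfl rfl
  rw [jet2_mem_classF' hg.2.1] at hL'
  simp only [hzf] at hL' h1 h2
  refine ⟨hL'.1, _, h1, fun w hw S hS => ?_⟩
  have h3 := h2 w
  rw [hfQ, ← hS, hw] at h3
  rw [hL'.2, h3]
  ring

/-- Take `k` to be the preimage of the vertical vector: a tangent hyperplane projects injectively
after `Φ` as soon as it does not contain `k`. -/
theorem exists_kernel (hΦ : IsPointTransformation Φ) (hz : z ∈ Φ.source) :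
    ∃ k : Vars, k ≠ 0 ∧ ∀ ℓ : Base →L[ℝ] ℝ, ℓ k.1 ≠ k.2 → IsTransversal Φ z ℓ := by
  have hb := hΦ.bijective_fderiv hz
  obtain ⟨k, hk⟩ := hb.2 (0, 1)
  refine ⟨k, ?_, fun ℓ hℓ => ?_⟩
  · rintro rfl
    simpa using congrArg Prod.snd hk
  · have hinj : ∀ v, (fderiv ℝ Φ z (v, ℓ v)).1 = 0 → v = 0 := by
      intro v hv
      set c := (fderiv ℝ Φ z (v, ℓ v)).2 with hc
      have h1 : fderiv ℝ Φ z (v, ℓ v) = fderiv ℝ Φ z (c • k) := by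
        rw [map_smul, hk]
        refine Prod.ext ?_ ?_
        · simp [hv]
        · simp [← hc]
      have h2 := hb.1 h1
      have h3 : v = c • k.1 := congrArg Prod.fst h2
      have h4 : ℓ v = c * k.2 := congrArg Prod.snd h2
      rw [h3, map_smul, smul_eq_mul] at h4
      have h5 : c * (ℓ k.1 - k.2) = 0 := by linarith
      rcases mul_eq_zero.1 h5 with h | h
      · rw [h3, h, zero_smul]
      · exact absurd (by linarith) hℓ
    intro v v' h
    have : (fderiv ℝ Φ z (v - v', ℓ (v - v'))).1 = 0 := by
      have e : ((v - v', ℓ (v - v')) : Vars) = (v, ℓ v) - (v', ℓ v') := by simp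
      rw [e, map_sub, Prod.fst_sub, sub_eq_zero]
      exact h
    exact sub_eq_zero.1 (hinj _ this)

/-- The coordinate functional `x`. -/
noncomputable def xCoord : Base →L[ℝ] ℝ :=
  (ContinuousLinearMap.fst ℝ ℝ ℝ).comp (ContinuousLinearMap.snd ℝ ℝ (ℝ × ℝ))

/-- The coordinate functional `t`. -/
noncomputable def tCoord : Base →L[ℝ] ℝ := ContinuousLinearMap.fst ℝ ℝ (ℝ × ℝ)

/-- The coordinate functional `y`. -/
noncomputable def yCoord : Base →L[ℝ] ℝ :=
  (ContinuousLinearMap.snd ℝ ℝ ℝ).comp (ContinuousLinearMap.snd ℝ ℝ (ℝ × ℝ))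

@[simp] theorem xCoord_apply (v : Base) : xCoord v = v.2.1 := rfl
@[simp] theorem tCoord_apply (v : Base) : tCoord v = v.1 := rfl
@[simp] theorem yCoord_apply (v : Base) : yCoord v = v.2.2 := rfl

/-- Provides several values of `u_x` at once. The sign `σ` is chosen so that adding `n σ` to `u_x`
moves `ℓ k.1 - k.2` away from zero for every `n ≥ 0`. -/
theorem exists_transversal_family (hΦ : IsPointTransformation Φ) (hz : z ∈ Φ.source) :
    ∃ (ℓ : Base →L[ℝ] ℝ) (σ : ℝ), σ ≠ 0 ∧
      ∀ n : ℝ, 0 ≤ n → IsTransversal Φ z (ℓ + (n * σ) • xCoord) := by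
  obtain ⟨⟨⟨kt, kx, ky⟩, ku⟩, hk0, hk⟩ := exists_kernel hΦ hz
  have h1 : ∃ ℓ : Base →L[ℝ] ℝ, ℓ (kt, kx, ky) - ku ≠ 0 := by
    by_contra! h
    have a0 := h 0
    have a1 := h tCoord
    have a2 := h xCoord
    have a3 := h yCoord
    simp at a0 a1 a2 a3
    subst a0
    simp at a1 a2 a3
    simp [a1, a2, a3] at hk0
  obtain ⟨ℓ, hℓ⟩ := h1
  set c := ℓ (kt, kx, ky) - ku with hc
  have h2 : ∃ σ : ℝ, σ ≠ 0 ∧ 0 ≤ (σ * kx) * c := by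
    rcases le_total 0 (kx * c) with h | h
    · exact ⟨1, one_ne_zero, by linarith⟩
    · exact ⟨-1, by norm_num, by linarith⟩
  obtain ⟨σ, hσ, hs⟩ := h2
  refine ⟨ℓ, σ, hσ, fun n hn => hk _ fun h => ?_⟩
  simp at h
  have h3 : c = -(n * (σ * kx)) := by rw [hc]; linarith
  have h4 : 0 < c * c := mul_self_pos.2 hℓ
  have h5 : c * c = - (n * (σ * kx * c)) := by
    nth_rewrite 1 [h3]; ring
  have h6 := mul_nonneg hn hs
  linarith

theorem exists_transversal (hΦ : IsPointTransformation Φ) (hz : z ∈ Φ.source) :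
    ∃ ℓ : Base →L[ℝ] ℝ, IsTransversal Φ z ℓ := by
  obtain ⟨ℓ, σ, -, h⟩ := exists_transversal_family hΦ hz
  exact ⟨_, h 0 le_rfl⟩

/-- The symmetric bilinear form `c * (ℓ ⊗ ℓ)`. -/
noncomputable def squareForm (c : ℝ) (ℓ : Base →L[ℝ] ℝ) : Base →L[ℝ] Base →L[ℝ] ℝ :=
  (c • ℓ).smulRight ℓ

@[simp] theorem squareForm_apply (c : ℝ) (ℓ : Base →L[ℝ] ℝ) (v w : Base) :
    squareForm c ℓ v w = c * ℓ v * ℓ w := by simp [squareForm]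

theorem exists_hessian (hx : z.1.2.1 ≠ 0) (ℓ : Base →L[ℝ] ℝ) (β : ℝ) :
    ∃ c : ℝ, ℓ (1, 0, z.1.2.1) = |z.1.2.1| ^ β * c := by
  have := (Real.rpow_pos_of_pos (abs_pos.2 hx) β).ne'
  exact ⟨ℓ (1, 0, z.1.2.1) / |z.1.2.1| ^ β, by field_simp⟩

/-- Some solution jet at `z` has a transversal graph, and its image must lie in the target equation,
which excludes `X = 0`. -/
theorem x_ne_zero_of_admissible (hT : (⟨β, Φ, β'⟩ : Arrow ℝ) ∈ equivalenceGroupoid classF')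
    (hz : z ∈ Φ.source) (hx : z.1.2.1 ≠ 0) : (Φ z).1.2.1 ≠ 0 := by
  obtain ⟨ℓ, hℓ⟩ := exists_transversal hT.1 hz
  obtain ⟨c, hc⟩ := exists_hessian hx ℓ β
  exact (admissible_relation hT hz hx hℓ (Q := squareForm c xCoord) (by simpa using hc)).1

theorem x_ne_zero_iff_of_admissible (hT : (⟨β, Φ, β'⟩ : Arrow ℝ) ∈ equivalenceGroupoid classF')
    (hz : z ∈ Φ.source) : z.1.2.1 ≠ 0 ↔ (Φ z).1.2.1 ≠ 0 := by
  refine ⟨x_ne_zero_of_admissible hT hz, fun h => ?_⟩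
  have := x_ne_zero_of_admissible (symm_mem_equivalenceGroupoid hT) (Φ.map_source hz) h
  rwa [Φ.left_inv hz] at this

theorem IsTransversal.bijective {ℓ : Base →L[ℝ] ℝ} (hℓ : IsTransversal Φ z ℓ) :
    Function.Bijective fun v => (fderiv ℝ Φ z (v, ℓ v)).1 := by
  let L : Base →L[ℝ] Base := ((ContinuousLinearMap.fst ℝ Base ℝ).comp (fderiv ℝ Φ z)).comp
    ((ContinuousLinearMap.id ℝ Base).prod ℓ)
  have h : Function.Injective (L : Base →ₗ[ℝ] Base) := hℓ
  exact ⟨hℓ, LinearMap.injective_iff_surjective.1 h⟩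

/-- If `m` is the gradient of the image of a graph, then `Φ` moves vertical vectors transversally
to the image. -/
theorem vertical_coeff_ne_zero (hΦ : IsPointTransformation Φ) (hz : z ∈ Φ.source)
    {ℓ m : Base →L[ℝ] ℝ}
    (hm : ∀ v, (fderiv ℝ Φ z (v, ℓ v)).2 = m (fderiv ℝ Φ z (v, ℓ v)).1) :
    (fderiv ℝ Φ z (0, 1)).2 - m (fderiv ℝ Φ z (0, 1)).1 ≠ 0 := by
  intro h0
  obtain ⟨⟨v, s⟩, hk⟩ := (hΦ.bijective_fderiv hz).2 (0, 1)
  have e : ((v, s) : Vars) = (v, ℓ v) + (s - ℓ v) • (0, 1) := by simp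
  have h1 := hm v
  rw [e, map_add, map_smul] at hk
  have k1 := congrArg Prod.fst hk
  have k2 := congrArg Prod.snd hk
  simp only [Prod.fst_add, Prod.snd_add, Prod.smul_fst, Prod.smul_snd, smul_eq_mul] at k1 k2
  have k3 := congrArg m k1
  rw [map_add, map_smul, map_zero, smul_eq_mul] at k3
  have : (s - ℓ v) * ((fderiv ℝ Φ z (0, 1)).2 - m (fderiv ℝ Φ z (0, 1)).1) = 1 := by linarith
  rw [h0] at this
  simp at this

/-- The total `x`-derivatives of the transformed `t` and `y` vanish. -/
theorem transversal_direction (hT : (⟨β, Φ, β'⟩ : Arrow ℝ) ∈ equivalenceGroupoid classF')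
    (hz : z ∈ Φ.source) (hx : z.1.2.1 ≠ 0) {ℓ : Base →L[ℝ] ℝ} (hℓ : IsTransversal Φ z ℓ)
    {w : Base} (hw : (fderiv ℝ Φ z (w, ℓ w)).1 = (0, 1, 0)) : w.1 = 0 ∧ w.2.2 = 0 := by
  obtain ⟨c, hc⟩ := exists_hessian hx ℓ β
  have key : ∀ μ : Base →L[ℝ] ℝ, μ (0, 1, 0) = 0 → μ w = 0 := by
    intro μ hμ
    obtain ⟨hX, m, hm, h1⟩ := admissible_relation hT hz hx hℓ (Q := squareForm c xCoord)
      (by simpa using hc)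
    -- Adding the square of `μ` to the Hessian preserves the equation, as `μ` kills `∂_x`, and keeps
    -- the 1-jet, hence `m`. Subtracting the two relations leaves `(μ w)²` times the nonzero
    -- vertical coefficient.
    obtain ⟨-, m', hm', h2⟩ := admissible_relation hT hz hx hℓ
      (Q := squareForm c xCoord + squareForm 1 μ) (by simpa [hμ] using hc)
    have hmm : m = m' := by
      refine ContinuousLinearMap.coe_injective (LinearMap.ext fun y => ?_)
      obtain ⟨v, rfl⟩ := hℓ.bijective.2 y
      exact (hm v).symm.trans (hm' v)
    subst hmm
    have e1 := h1 w hw _ rfl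
    have e2 := h2 w hw _ rfl
    have hκ := vertical_coeff_ne_zero (Φ := Φ) hT.1 hz hm
    have hpos := (Real.rpow_pos_of_pos (abs_pos.2 hX) β').ne'
    have e3 := mul_left_cancel₀ hpos (e1.symm.trans e2)
    have hs : ∀ s : ℝ, fderiv ℝ Φ z (0, s) = s • fderiv ℝ Φ z (0, 1) := by
      intro s; rw [← map_smul]; simp
    rw [hs (squareForm c xCoord w w), hs ((squareForm c xCoord + squareForm 1 μ) w w)] at e3
    simp only [Prod.fst_add, Prod.snd_add, Prod.smul_fst, Prod.smul_snd, smul_eq_mul, map_add,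
      map_smul, add_apply, squareForm_apply] at e3
    have e4 : (μ w * μ w) * ((fderiv ℝ Φ z (0, 1)).2 - m (fderiv ℝ Φ z (0, 1)).1) = 0 := by
      linarith
    exact mul_self_eq_zero.1 ((mul_eq_zero.1 e4).resolve_right hκ)
  exact ⟨key tCoord rfl, key yCoord rfl⟩

/-- `transversal_direction` makes the total derivatives `T_x + u_x T_u` and `Y_x + u_x Y_u` vanish;
two distinct values of `u_x` separate the terms. -/
theorem fderiv_x_u_of_admissible (hT : (⟨β, Φ, β'⟩ : Arrow ℝ) ∈ equivalenceGroupoid classF')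
    (hz : z ∈ Φ.source) (hx : z.1.2.1 ≠ 0) :
    ((fderiv ℝ Φ z ((0, 1, 0), 0)).1.1 = 0 ∧ (fderiv ℝ Φ z ((0, 1, 0), 0)).1.2.2 = 0) ∧
      (fderiv ℝ Φ z (0, 1)).1.1 = 0 ∧ (fderiv ℝ Φ z (0, 1)).1.2.2 = 0 := by
  obtain ⟨ℓ, σ, hσ, h⟩ := exists_transversal_family hT.1 hz
  have key : ∀ ℓ : Base →L[ℝ] ℝ, IsTransversal Φ z ℓ →
      (fderiv ℝ Φ z ((0, 1, 0), 0) + ℓ (0, 1, 0) • fderiv ℝ Φ z (0, 1)).1.1 = 0 ∧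
      (fderiv ℝ Φ z ((0, 1, 0), 0) + ℓ (0, 1, 0) • fderiv ℝ Φ z (0, 1)).1.2.2 = 0 := by
    intro ℓ hℓ
    obtain ⟨⟨wt, wx, wy⟩, hw⟩ := hℓ.bijective.2 (0, 1, 0)
    obtain ⟨h1, h2⟩ := transversal_direction hT hz hx hℓ hw
    simp only at h1 h2
    subst h1 h2
    have e : (((0, wx, 0), ℓ (0, wx, 0)) : Vars) =
        wx • (((0, 1, 0), 0) + ℓ (0, 1, 0) • (0, 1)) := by
      have : ((0, wx, 0) : Base) = wx • (0, 1, 0) := by simp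
      rw [this, map_smul]
      simp
    simp only [e, map_smul, map_add] at hw
    set r := fderiv ℝ Φ z ((0, 1, 0), 0) + ℓ (0, 1, 0) • fderiv ℝ Φ z (0, 1)
    have w1 := congrArg Prod.fst hw
    have w2 := congrArg (fun y : Base => y.2.1) hw
    have w3 := congrArg (fun y : Base => y.2.2) hw
    simp only [Prod.smul_fst, Prod.smul_snd, smul_eq_mul] at w1 w2 w3
    have hwx : wx ≠ 0 := by rintro rfl; simp at w2
    exact ⟨(mul_eq_zero.1 w1).resolve_left hwx, (mul_eq_zero.1 w3).resolve_left hwx⟩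
  have h0 := key _ (h 0 le_rfl)
  have h1 := key _ (h 1 zero_le_one)
  simp at h0 h1
  have u1 : (fderiv ℝ Φ z (0, 1)).1.1 = 0 :=
    (mul_eq_zero.1 (by linarith [h0.1, h1.1] : σ * (fderiv ℝ Φ z (0, 1)).1.1 = 0)).resolve_left hσ
  have u2 : (fderiv ℝ Φ z (0, 1)).1.2.2 = 0 :=
    (mul_eq_zero.1 (by linarith [h0.2, h1.2] : σ * (fderiv ℝ Φ z (0, 1)).1.2.2 = 0)).resolve_left hσ
  rw [u1, u2] at h0
  exact ⟨by simpa using h0, u1, u2⟩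

end Point

/-! ### First-order determining equations at points with `x ≠ 0` -/

section Point

variable {Φ : OpenPartialHomeomorph Vars Vars} {β β' : ℝ} {z : Vars}

theorem fderiv_fderiv_apply_eq_zero (hΦ : IsPointTransformation Φ) (hz : z ∈ Φ.source)
    (L : Vars →L[ℝ] ℝ) (a v : Vars) (h : ∀ᶠ z' in 𝓝 z, L (fderiv ℝ Φ z' a) = 0) :
    L (fderiv ℝ (fderiv ℝ Φ) z v a) = 0 := by
  have h1 : HasFDerivAt (fderiv ℝ Φ) (fderiv ℝ (fderiv ℝ Φ) z) z :=
    (((hΦ.contDiffAt hz).fderiv_right (m := 1) (by norm_cast)).differentiableAt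
      (by simp)).hasFDerivAt
  have h2 := L.hasFDerivAt.comp z (h1.clm_apply (hasFDerivAt_const a z))
  have h3 : HasFDerivAt (fun z' => L (fderiv ℝ Φ z' a)) (0 : Vars →L[ℝ] ℝ) z :=
    (hasFDerivAt_const (0 : ℝ) z).congr_of_eventuallyEq h
  have h4 := congrArg (fun M : Vars →L[ℝ] ℝ => M v) (h2.unique h3)
  simpa using h4

theorem eventually_mem_and_x_ne_zero (hz : z ∈ Φ.source) (hx : z.1.2.1 ≠ 0) :
    ∀ᶠ z' in 𝓝 z, z' ∈ Φ.source ∧ z'.1.2.1 ≠ 0 := by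
  have h : ∀ᶠ z' in 𝓝 z, z' ∈ Φ.source := Φ.open_source.mem_nhds hz
  exact h.and <| (isOpen_ne_fun (f := fun z' : Vars => z'.1.2.1) (by fun_prop) continuous_const).mem_nhds hx

/-- Ensures that the base part of the second-order term in the prolongation is a multiple of `∂_X`,
so that it is insensitive to changes of the image gradient in other directions. -/
theorem second_order_base (hT : (⟨β, Φ, β'⟩ : Arrow ℝ) ∈ equivalenceGroupoid classF')
    (hz : z ∈ Φ.source) (hx : z.1.2.1 ≠ 0) (r s : ℝ) (v : Vars) :
    (fderiv ℝ (fderiv ℝ Φ) z v ((0, r, 0), s)).1.1 = 0 ∧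
      (fderiv ℝ (fderiv ℝ Φ) z v ((0, r, 0), s)).1.2.2 = 0 := by
  have e : (((0, r, 0), s) : Vars) = r • ((0, 1, 0), 0) + s • (0, 1) := by simp
  have h : ∀ᶠ z' in 𝓝 z, (fderiv ℝ Φ z' ((0, r, 0), s)).1.1 = 0 ∧
      (fderiv ℝ Φ z' ((0, r, 0), s)).1.2.2 = 0 := by
    filter_upwards [eventually_mem_and_x_ne_zero hz hx] with z' hz'
    obtain ⟨⟨h1, h2⟩, h3, h4⟩ := fderiv_x_u_of_admissible hT hz'.1 hz'.2
    rw [e, map_add, map_smul, map_smul]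
    simp [h1, h2, h3, h4]
  exact ⟨fderiv_fderiv_apply_eq_zero hT.1 hz
      (tCoord.comp (ContinuousLinearMap.fst ℝ Base ℝ)) _ v (h.mono fun z' h => h.1),
    fderiv_fderiv_apply_eq_zero hT.1 hz
      (yCoord.comp (ContinuousLinearMap.fst ℝ Base ℝ)) _ v (h.mono fun z' h => h.2)⟩

theorem IsTransversal.injective_iff {ℓ : Base →L[ℝ] ℝ} :
    IsTransversal Φ z ℓ ↔ ∀ v, (fderiv ℝ Φ z (v, ℓ v)).1 = 0 → v = 0 := by
  let L : Base →L[ℝ] Base := ((ContinuousLinearMap.fst ℝ Base ℝ).comp (fderiv ℝ Φ z)).comp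
    ((ContinuousLinearMap.id ℝ Base).prod ℓ)
  exact injective_iff_map_eq_zero L

theorem fderiv_graph_add (ℓ h : Base →L[ℝ] ℝ) (v : Base) :
    fderiv ℝ Φ z (v, (ℓ + h) v) = fderiv ℝ Φ z (v, ℓ v) + h v • fderiv ℝ Φ z (0, 1) := by
  rw [← map_smul, ← map_add]; simp

theorem eq_smul_of_fst_eq_zero {y : Base} (h1 : y.1 = 0) (h2 : y.2.2 = 0) :
    y = y.2.1 • (0, 1, 0) := by
  obtain ⟨a, b, c⟩ := y
  simp_all

/-- The vertical vector has base image along `∂_X`, so any kernel vector of the perturbed plane is a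
multiple of `(0, r, 0)`, where `h` vanishes; the original transversality then finishes. -/
theorem IsTransversal.add {ℓ h : Base →L[ℝ] ℝ} (hℓ : IsTransversal Φ z ℓ)
    (h1 : (fderiv ℝ Φ z (0, 1)).1.1 = 0) (h2 : (fderiv ℝ Φ z (0, 1)).1.2.2 = 0)
    {r : ℝ} (hw : (fderiv ℝ Φ z ((0, r, 0), ℓ (0, r, 0))).1 = (0, 1, 0))
    (hh : h (0, 1, 0) = 0) : IsTransversal Φ z (ℓ + h) := by
  rw [IsTransversal.injective_iff]
  intro v hv
  rw [fderiv_graph_add, Prod.fst_add, Prod.smul_fst, eq_smul_of_fst_eq_zero h1 h2] at hv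
  set X := (fderiv ℝ Φ z (0, 1)).1.2.1
  have e : (fderiv ℝ Φ z (v, ℓ v)).1 =
      (fderiv ℝ Φ z ((-(h v * X)) • (0, r, 0), ℓ ((-(h v * X)) • (0, r, 0)))).1 := by
    have : (((-(h v * X)) • (0, r, 0), ℓ ((-(h v * X)) • (0, r, 0))) : Vars) =
        (-(h v * X)) • ((0, r, 0), ℓ (0, r, 0)) := by
      rw [map_smul]; rfl
    rw [this, map_smul, Prod.smul_fst, hw, eq_neg_of_add_eq_zero_left hv, smul_smul, neg_smul]
  have e1 : v = (-(h v * X)) • (0, r, 0) := hℓ e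
  have e2 : h v = 0 := by
    rw [e1, map_smul]
    have : ((0, r, 0) : Base) = r • (0, 1, 0) := by simp
    rw [this, map_smul, hh]
    simp
  rw [e1, e2]
  simp

/-- Perturb `u_t`, `u_y` by `h` and `u_xx` by the amount `d` that keeps the equation. With `κ` the
vertical coefficient, the image gradient is unchanged on `∂_X` and changes by `h v * κ` on `(1, 0,
X)`, while the second `X`-derivative of the image changes by `r ^ 2 * d * κ`. Cancelling `κ` gives
the relation. -/
theorem determining_relation (hT : (⟨β, Φ, β'⟩ : Arrow ℝ) ∈ equivalenceGroupoid classF')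
    (hz : z ∈ Φ.source) (hx : z.1.2.1 ≠ 0) {ℓ h : Base →L[ℝ] ℝ} (hℓ : IsTransversal Φ z ℓ)
    {r : ℝ} (hw : (fderiv ℝ Φ z ((0, r, 0), ℓ (0, r, 0))).1 = (0, 1, 0))
    {v : Base} (hv : (fderiv ℝ Φ z (v, ℓ v)).1 = (1, 0, (Φ z).1.2.1))
    (hh : h (0, 1, 0) = 0) :
    |z.1.2.1| ^ β * h v = |(Φ z).1.2.1| ^ β' * r ^ 2 * h (1, 0, z.1.2.1) := by
  obtain ⟨-, hu1, hu2⟩ := fderiv_x_u_of_admissible hT hz hx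
  have hℓ' := hℓ.add hu1 hu2 hw hh
  have hhw : h (0, r, 0) = 0 := by
    have : ((0, r, 0) : Base) = r • (0, 1, 0) := by simp
    rw [this, map_smul, hh, smul_zero]
  obtain ⟨c, hc⟩ := exists_hessian hx ℓ β
  obtain ⟨d, hd⟩ := exists_hessian hx h β
  obtain ⟨-, m, hm, h1⟩ := admissible_relation hT hz hx hℓ (Q := squareForm c xCoord)
    (by simpa using hc)
  obtain ⟨-, m', hm', h2⟩ := admissible_relation hT hz hx hℓ'
    (Q := squareForm (c + d) xCoord) (by simp [hc, hd]; ring)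
  have hκ := vertical_coeff_ne_zero (Φ := Φ) hT.1 hz hm
  have hw' : fderiv ℝ Φ z ((0, r, 0), (ℓ + h) (0, r, 0)) =
      fderiv ℝ Φ z ((0, r, 0), ℓ (0, r, 0)) := by
    rw [fderiv_graph_add, hhw, zero_smul, add_zero]
  have hpt : (((0, r, 0), (ℓ + h) (0, r, 0)) : Vars) = ((0, r, 0), ℓ (0, r, 0)) := by
    rw [add_apply, hhw, add_zero]
  have mw := hm (0, r, 0)
  have mw' := hm' (0, r, 0)
  rw [hw'] at mw'
  rw [hw] at mw mw'
  have hmx : m' (0, 1, 0) = m (0, 1, 0) := mw'.symm.trans mw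
  have hmm : ∀ y : Base, y.1 = 0 → y.2.2 = 0 → m' y = m y := by
    intro y h1 h2
    rw [eq_smul_of_fst_eq_zero h1 h2, map_smul, map_smul, hmx]
  have e1 := h1 _ hw _ rfl
  have e2 := h2 _ (by rw [hw', hw]) _ rfl
  rw [hpt] at e2
  have hs : ∀ s : ℝ, fderiv ℝ Φ z (0, s) = s • fderiv ℝ Φ z (0, 1) := by
    intro s; rw [← map_smul]; simp
  rw [hs (squareForm _ _ _ _)] at e1 e2
  simp only [Prod.fst_add, Prod.snd_add, Prod.smul_fst, Prod.smul_snd, smul_eq_mul, map_add,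
    map_smul, squareForm_apply, xCoord_apply] at e1 e2
  obtain ⟨s1, s2⟩ := second_order_base hT hz hx r (ℓ (0, r, 0)) ((0, r, 0), ℓ (0, r, 0))
  rw [hmm _ s1 s2, hmm _ hu1 hu2] at e2
  have e3 := hm' v
  rw [fderiv_graph_add, Prod.fst_add, Prod.snd_add, Prod.smul_fst, Prod.smul_snd, map_add,
    map_smul, hmm _ hu1 hu2, hm v, hv] at e3
  simp only [smul_eq_mul] at e3
  rw [hd]
  set κ := (fderiv ℝ Φ z (0, 1)).2 - m (fderiv ℝ Φ z (0, 1)).1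
  have e4 : h v * κ = |(Φ z).1.2.1| ^ β' * r ^ 2 * d * κ := by
    simp only [κ]
    linear_combination e3 + e2 - e1
  rw [mul_right_cancel₀ hκ e4]
  ring

/-- Taking `h` to be `tCoord` and `yCoord` shows that the preimage of `(1, 0, X)` is a multiple of
`(1, 0, x)` up to `∂_x`. Pushing it forward again, where `∂_x` and `∂_u` do not contribute to `T`
and `Y`, expresses everything through `DT` and `DY`. -/
theorem transversal_relations (hT : (⟨β, Φ, β'⟩ : Arrow ℝ) ∈ equivalenceGroupoid classF')
    (hz : z ∈ Φ.source) (hx : z.1.2.1 ≠ 0) {ℓ : Base →L[ℝ] ℝ} (hℓ : IsTransversal Φ z ℓ) :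
    (Φ z).1.2.1 * (fderiv ℝ Φ z ((1, 0, z.1.2.1), 0)).1.1 =
        (fderiv ℝ Φ z ((1, 0, z.1.2.1), 0)).1.2.2 ∧
      |z.1.2.1| ^ β * ((fderiv ℝ Φ z ((0, 1, 0), 0)).1.2.1 +
        ℓ (0, 1, 0) * (fderiv ℝ Φ z (0, 1)).1.2.1) ^ 2 =
        |(Φ z).1.2.1| ^ β' * (fderiv ℝ Φ z ((1, 0, z.1.2.1), 0)).1.1 ∧
      (fderiv ℝ Φ z ((0, 1, 0), 0)).1.2.1 + ℓ (0, 1, 0) * (fderiv ℝ Φ z (0, 1)).1.2.1 ≠ 0 := by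
  obtain ⟨⟨hx1, hx2⟩, hu1, hu2⟩ := fderiv_x_u_of_admissible hT hz hx
  obtain ⟨⟨wt, r, wy⟩, hw⟩ := hℓ.bijective.2 (0, 1, 0)
  obtain ⟨h1, h2⟩ := transversal_direction hT hz hx hℓ hw
  simp only at h1 h2 hw
  subst h1 h2
  obtain ⟨⟨vt, vx, vy⟩, hv⟩ := hℓ.bijective.2 (1, 0, (Φ z).1.2.1)
  simp only at hv
  have k1 := determining_relation hT hz hx (h := tCoord) hℓ hw hv (by simp)
  have k2 := determining_relation hT hz hx (h := yCoord) hℓ hw hv (by simp)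
  simp only [tCoord_apply, yCoord_apply, mul_one] at k1 k2
  have hpos := (Real.rpow_pos_of_pos (abs_pos.2 hx) β)
  have hvy : vy = z.1.2.1 * vt := by
    refine mul_left_cancel₀ hpos.ne' ?_
    rw [k2, ← k1]; ring
  subst hvy
  have hwe : (((0, r, 0), ℓ (0, r, 0)) : Vars) = r • (((0, 1, 0), 0) + ℓ (0, 1, 0) • (0, 1)) := by
    have : ((0, r, 0) : Base) = r • (0, 1, 0) := by simp
    rw [this, map_smul]
    simp
  have hve : (((vt, vx, z.1.2.1 * vt), ℓ (vt, vx, z.1.2.1 * vt)) : Vars) =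
      vt • ((1, 0, z.1.2.1), 0) + vx • ((0, 1, 0), 0) +
        ℓ (vt, vx, z.1.2.1 * vt) • (0, 1) := by
    simp [mul_comm]
  rw [hwe, map_smul, map_add, map_smul] at hw
  rw [hve, map_add, map_add, map_smul, map_smul, map_smul] at hv
  have w2 := congrArg (fun y : Base => y.2.1) hw
  have v1 := congrArg (fun y : Base => y.1) hv
  have v3 := congrArg (fun y : Base => y.2.2) hv
  simp only [Prod.fst_add, Prod.snd_add, Prod.smul_fst, Prod.smul_snd, smul_eq_mul,
    hx1, hx2, hu1, hu2, mul_zero, add_zero] at w2 v1 v3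
  set X := (Φ z).1.2.1
  set R := (fderiv ℝ Φ z ((0, 1, 0), 0)).1.2.1 + ℓ (0, 1, 0) * (fderiv ℝ Φ z (0, 1)).1.2.1
  set l₂ := (fderiv ℝ Φ z ((1, 0, z.1.2.1), 0)).1.1
  set l₁ := (fderiv ℝ Φ z ((1, 0, z.1.2.1), 0)).1.2.2
  refine ⟨?_, ?_, fun h => by rw [h] at w2; simp at w2⟩
  · rw [← v3]
    linear_combination (l₁) * v1
  · have h3 : |z.1.2.1| ^ β * R ^ 2 * (vt * l₂) = |X| ^ β' * (r * R) ^ 2 * l₂ := by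
      linear_combination (R ^ 2 * l₂) * k1
    rw [v1, w2] at h3
    linarith

/-- The first-order determining equations of admissible transformations. -/
theorem determining_equations (hT : (⟨β, Φ, β'⟩ : Arrow ℝ) ∈ equivalenceGroupoid classF')
    (hz : z ∈ Φ.source) (hx : z.1.2.1 ≠ 0) :
    (fderiv ℝ Φ z (0, 1)).1 = 0 ∧
      (Φ z).1.2.1 * (fderiv ℝ Φ z ((1, 0, z.1.2.1), 0)).1.1 =
        (fderiv ℝ Φ z ((1, 0, z.1.2.1), 0)).1.2.2 ∧
      |z.1.2.1| ^ β * (fderiv ℝ Φ z ((0, 1, 0), 0)).1.2.1 ^ 2 =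
        |(Φ z).1.2.1| ^ β' * (fderiv ℝ Φ z ((1, 0, z.1.2.1), 0)).1.1 := by
  obtain ⟨-, hu1, hu2⟩ := fderiv_x_u_of_admissible hT hz hx
  obtain ⟨ℓ, σ, hσ, hℓ⟩ := exists_transversal_family hT.1 hz
  obtain ⟨e0, a0, n0⟩ := transversal_relations hT hz hx (hℓ 0 le_rfl)
  obtain ⟨-, a1, -⟩ := transversal_relations hT hz hx (hℓ 1 zero_le_one)
  obtain ⟨-, a2, -⟩ := transversal_relations hT hz hx (hℓ 2 zero_le_two)
  have hpos := (Real.rpow_pos_of_pos (abs_pos.2 hx) β).ne'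
  have b1 := mul_left_cancel₀ hpos (a1.trans a0.symm)
  have b2 := mul_left_cancel₀ hpos (a2.trans a0.symm)
  simp only [add_apply, smul_apply, xCoord_apply, smul_eq_mul, zero_mul, one_mul, mul_one,
    add_zero] at b1 b2 a0
  set X := (fderiv ℝ Φ z (0, 1)).1.2.1 with hX
  -- A second difference: the square of an affine function of `n` agrees at `n = 0, 1, 2`, so its
  -- slope vanishes. Two values would still permit a change of sign.
  have c : (σ * X) ^ 2 = 0 := by linear_combination (1 / 2 : ℝ) * b2 - b1
  have hX0 : X = 0 := (mul_eq_zero.1 (pow_eq_zero_iff (two_ne_zero) |>.1 c)).resolve_left hσ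
  rw [hX0, mul_zero, add_zero] at a0
  refine ⟨?_, e0, a0⟩
  exact Prod.ext hu1 (Prod.ext hX0 hu2)

end Point

/-! ### Classification of the exponents -/

/-- Three equally spaced points suffice; they are placed in a subinterval lying on one side of 0,
where the hypothesis is available. -/
theorem quadratic_coeffs_eq_zero {a b c₀ c₁ c₂ : ℝ} (hab : a < b)
    (h : ∀ x ∈ Ioo a b, x ≠ 0 → c₀ + c₁ * x + c₂ * x ^ 2 = 0) : c₀ = 0 ∧ c₁ = 0 ∧ c₂ = 0 := by
  have h1 : ∃ s δ : ℝ, 0 < δ ∧ ∀ x ∈ Icc (s - δ) (s + δ), x ∈ Ioo a b ∧ x ≠ 0 := by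
    rcases le_or_gt b 0 with hb | hb
    · refine ⟨(a + b) / 2, (b - a) / 4, by linarith, fun x hx => ?_⟩
      have h1 := hx.1
      have h2 := hx.2
      have hx' : x < b := by linarith
      exact ⟨⟨by linarith, hx'⟩, by linarith⟩
    · have hm : max a 0 < b := max_lt hab hb
      have m1 := le_max_left a 0
      have m2 := le_max_right a 0
      refine ⟨(max a 0 + b) / 2, (b - max a 0) / 4, by linarith, fun x hx => ?_⟩
      have h1 := hx.1
      have h2 := hx.2
      have hx' : max a 0 < x := by linarith
      exact ⟨⟨by linarith, by linarith⟩, by linarith⟩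
  obtain ⟨s, δ, hδ, hs⟩ := h1
  have k : ∀ x ∈ Icc (s - δ) (s + δ), c₀ + c₁ * x + c₂ * x ^ 2 = 0 :=
    fun x hx => h x (hs x hx).1 (hs x hx).2
  have k0 := k s ⟨by linarith, by linarith⟩
  have k1 := k (s - δ) ⟨by linarith, by linarith⟩
  have k2 := k (s + δ) ⟨by linarith, by linarith⟩
  have z2 : c₂ = 0 := by
    have : c₂ * δ ^ 2 = 0 := by linear_combination (k1 + k2) / 2 - k0
    exact (mul_eq_zero.1 this).resolve_right (by positivity)
  subst z2
  have z1 : c₁ = 0 := by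
    have : c₁ * δ = 0 := by linear_combination k2 - k0
    exact (mul_eq_zero.1 this).resolve_right hδ.ne'
  subst z1
  exact ⟨by linarith, rfl, rfl⟩

/-- `ξ` is fractional linear with `ξ' = (BC − AE)/(C + xE)²`, so the second hypothesis becomes
`|x|^β Δ² = |ξ|^β' (C + xE)^5`. Its logarithmic derivative, cleared of denominators, is a quadratic
in `x` whose three coefficients are the stated relations. -/
theorem exponent_relations {A B C E β β' a b : ℝ} (hab : a < b) (hΔ : B * C - A * E ≠ 0)
    {ξ ξ' : ℝ → ℝ} (hξ : ∀ x ∈ Ioo a b, HasDerivAt ξ (ξ' x) x)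
    (h1 : ∀ x ∈ Ioo a b, ξ x * (C + x * E) = A + x * B)
    (h2 : ∀ x ∈ Ioo a b, x ≠ 0 →
      ξ x ≠ 0 ∧ |x| ^ β * ξ' x ^ 2 = |ξ x| ^ β' * (C + x * E)) :
    (∀ x ∈ Ioo a b, C + x * E ≠ 0) ∧ β * (A * C) = 0 ∧
      (β - β') * (B * C) = (5 - β - β') * (E * A) ∧ (β - 5) * (B * E) = 0 := by
  have hl : ∀ x, HasDerivAt (fun x => C + x * E) E x := fun x => by
    simpa using ((hasDerivAt_id x).mul_const E).const_add C
  have hl' : ∀ x, HasDerivAt (fun x => A + x * B) B x := fun x => by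
    simpa using ((hasDerivAt_id x).mul_const B).const_add A
  have hd : ∀ x ∈ Ioo a b, ξ' x * (C + x * E) ^ 2 = B * C - A * E := by
    intro x hx
    have e1 := ((hξ x hx).mul (hl x)).unique
      ((hl' x).congr_of_eventuallyEq (eventually_of_mem (isOpen_Ioo.mem_nhds hx) h1))
    linear_combination (C + x * E) * e1 - E * h1 x hx
  have hne : ∀ x ∈ Ioo a b, C + x * E ≠ 0 := by
    intro x hx h
    have := hd x hx
    rw [h] at this
    exact hΔ (by rw [← this]; ring)
  -- `Real.log` is the logarithm of the absolute value, so the signs of `x`, `ξ x`, `C + x * E` and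
  -- the determinant play no role.
  have hlog : ∀ x ∈ Ioo a b, x ≠ 0 →
      β * Real.log x + 2 * Real.log (B * C - A * E) =
        β' * Real.log (ξ x) + 5 * Real.log (C + x * E) := by
    intro x hx hx0
    obtain ⟨k1, k2⟩ := h2 x hx hx0
    have k3 : |x| ^ β * (B * C - A * E) ^ 2 = |ξ x| ^ β' * (C + x * E) ^ 5 := by
      rw [← hd x hx]
      linear_combination (C + x * E) ^ 4 * k2
    have k4 := congrArg Real.log k3
    have p1 := (Real.rpow_pos_of_pos (abs_pos.2 hx0) β).ne'
    have p2 := (Real.rpow_pos_of_pos (abs_pos.2 k1) β').ne'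
    rw [Real.log_mul p1 (pow_ne_zero _ hΔ), Real.log_mul p2 (pow_ne_zero _ (hne x hx)),
      Real.log_rpow (abs_pos.2 hx0), Real.log_rpow (abs_pos.2 k1), Real.log_abs, Real.log_abs,
      Real.log_pow, Real.log_pow] at k4
    exact_mod_cast k4
  have hquad : ∀ x ∈ Ioo a b, x ≠ 0 →
      β * (A * C) + (β * (A * E + B * C) - β' * (B * C - A * E) - 5 * (E * A)) * x +
        ((β - 5) * (B * E)) * x ^ 2 = 0 := by
    intro x hx hx0
    have hξ0 := (h2 x hx hx0).1
    have d1 := ((Real.hasDerivAt_log hx0).const_mul β).add_const (2 * Real.log (B * C - A * E))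
    have d2 := (((hξ x hx).log hξ0).const_mul β').add (((hl x).log (hne x hx)).const_mul 5)
    have hev : ∀ᶠ x' in 𝓝 x, x' ∈ Ioo a b ∧ x' ≠ 0 :=
      Filter.Eventually.and (isOpen_Ioo.mem_nhds hx) (isOpen_ne.mem_nhds hx0)
    have e1 := d1.unique (d2.congr_of_eventuallyEq (hev.mono fun x' h => hlog x' h.1 h.2))
    have hl0 := hne x hx
    have hl1 : A + x * B ≠ 0 := by rw [← h1 x hx]; exact mul_ne_zero hξ0 hl0
    have hX : ξ x = (A + x * B) / (C + x * E) := by rw [← h1 x hx]; field_simp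
    have hX' : ξ' x = (B * C - A * E) / (C + x * E) ^ 2 := by rw [← hd x hx]; field_simp
    rw [hX, hX'] at e1
    field_simp at e1
    linear_combination e1
  obtain ⟨q0, q1, q2⟩ := quadratic_coeffs_eq_zero hab hquad
  exact ⟨hne, q0, by linear_combination q1, q2⟩

/-! ### Extension across `x = 0` and restriction to lines parallel to the `x`-axis -/

section Point

variable {Φ : OpenPartialHomeomorph Vars Vars} {β β' : ℝ} {z : Vars}

/-- The hyperplane `x = 0` has dense complement in the open domain: approach its points along the
`x`-direction. -/
theorem eq_zero_of_eq_zero_off_x_zero (hz : z ∈ Φ.source) {F : Vars → ℝ}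
    (hF : ContinuousAt F z) (h : ∀ z' ∈ Φ.source, z'.1.2.1 ≠ 0 → F z' = 0) : F z = 0 := by
  by_cases hx : z.1.2.1 = 0
  · have hc : Continuous fun s : ℝ => (((z.1.1, s, z.1.2.2), z.2) : Vars) := by fun_prop
    have hz0 : (((z.1.1, 0, z.1.2.2), z.2) : Vars) = z := by rw [← hx]
    have ht : Tendsto (fun s : ℝ => (((z.1.1, s, z.1.2.2), z.2) : Vars)) (𝓝[≠] 0) (𝓝 z) := by
      have := hc.tendsto 0
      rw [hz0] at this
      exact this.mono_left nhdsWithin_le_nhds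
    refine tendsto_nhds_unique_of_eventuallyEq (hF.tendsto.comp ht) tendsto_const_nhds ?_
    filter_upwards [ht.eventually (Φ.open_source.mem_nhds hz), self_mem_nhdsWithin] with s h1 h2
    exact h _ h1 h2
  · exact h z hz hx

theorem continuousAt_fderiv_apply (hΦ : IsPointTransformation Φ) (hz : z ∈ Φ.source) (a : Vars) :
    ContinuousAt (fun z' => fderiv ℝ Φ z' a) z :=
  (((hΦ.contDiffAt hz).fderiv_right (m := 0) (by norm_cast)).continuousAt).clm_apply
    continuousAt_const

theorem fderiv_direction (a b : ℝ) : fderiv ℝ Φ z ((1, 0, a), b) =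
    fderiv ℝ Φ z ((1, 0, 0), 0) + a • fderiv ℝ Φ z ((0, 0, 1), 0) + b • fderiv ℝ Φ z (0, 1) := by
  rw [← map_smul, ← map_smul, ← map_add, ← map_add]; simp

/-- The determining equations without denominators hold on the whole domain. -/
theorem determining_equations_extended
    (hT : (⟨β, Φ, β'⟩ : Arrow ℝ) ∈ equivalenceGroupoid classF') (hz : z ∈ Φ.source) :
    ((fderiv ℝ Φ z ((0, 1, 0), 0)).1.1 = 0 ∧ (fderiv ℝ Φ z ((0, 1, 0), 0)).1.2.2 = 0) ∧
    (fderiv ℝ Φ z (0, 1)).1 = 0 ∧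
    (Φ z).1.2.1 * ((fderiv ℝ Φ z ((1, 0, 0), 0)).1.1 +
      z.1.2.1 * (fderiv ℝ Φ z ((0, 0, 1), 0)).1.1) =
      (fderiv ℝ Φ z ((1, 0, 0), 0)).1.2.2 + z.1.2.1 * (fderiv ℝ Φ z ((0, 0, 1), 0)).1.2.2 := by
  have hc := fun a => continuousAt_fderiv_apply hT.1 hz a
  have hΦc : ContinuousAt Φ z := Φ.continuousAt hz
  have hid : ContinuousAt (fun z' : Vars => z'.1.2.1) z := by fun_prop
  refine ⟨⟨?_, ?_⟩, Prod.ext ?_ (Prod.ext ?_ ?_), ?_⟩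
  · exact eq_zero_of_eq_zero_off_x_zero hz (hc _).fst.fst
      fun z' h h' => (fderiv_x_u_of_admissible hT h h').1.1
  · exact eq_zero_of_eq_zero_off_x_zero hz (hc _).fst.snd.snd
      fun z' h h' => (fderiv_x_u_of_admissible hT h h').1.2
  · exact eq_zero_of_eq_zero_off_x_zero hz (hc _).fst.fst
      fun z' h h' => congrArg Prod.fst (determining_equations hT h h').1
  · exact eq_zero_of_eq_zero_off_x_zero hz (hc _).fst.snd.fst
      fun z' h h' => congrArg (fun y : Base => y.2.1) (determining_equations hT h h').1
  · exact eq_zero_of_eq_zero_off_x_zero hz (hc _).fst.snd.snd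
      fun z' h h' => congrArg (fun y : Base => y.2.2) (determining_equations hT h h').1
  · rw [← sub_eq_zero]
    refine eq_zero_of_eq_zero_off_x_zero (F := fun z => (Φ z).1.2.1 *
      ((fderiv ℝ Φ z ((1, 0, 0), 0)).1.1 + z.1.2.1 * (fderiv ℝ Φ z ((0, 0, 1), 0)).1.1) -
      ((fderiv ℝ Φ z ((1, 0, 0), 0)).1.2.2 + z.1.2.1 * (fderiv ℝ Φ z ((0, 0, 1), 0)).1.2.2)) hz
      ?_ fun z' h h' => ?_
    · exact (hΦc.fst.snd.fst.mul ((hc _).fst.fst.add (hid.mul (hc _).fst.fst))).sub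
        ((hc _).fst.snd.snd.add (hid.mul (hc _).fst.snd.snd))
    · have := (determining_equations hT h h').2.1
      rw [fderiv_direction] at this
      simp at this
      linarith

/-- The Jacobian of the transformed `(t, y)` with respect to `(t, y)` does not vanish. -/
theorem jacobian_ne_zero (hT : (⟨β, Φ, β'⟩ : Arrow ℝ) ∈ equivalenceGroupoid classF')
    (hz : z ∈ Φ.source) :
    (fderiv ℝ Φ z ((0, 0, 1), 0)).1.2.2 * (fderiv ℝ Φ z ((1, 0, 0), 0)).1.1 -
      (fderiv ℝ Φ z ((1, 0, 0), 0)).1.2.2 * (fderiv ℝ Φ z ((0, 0, 1), 0)).1.1 ≠ 0 := by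
  obtain ⟨⟨x1, x2⟩, hu, -⟩ := determining_equations_extended hT hz
  have hs := (hT.1.bijective_fderiv hz).2
  have e : ∀ v : Vars, fderiv ℝ Φ z v = v.1.1 • fderiv ℝ Φ z ((1, 0, 0), 0) +
      v.1.2.1 • fderiv ℝ Φ z ((0, 1, 0), 0) + v.1.2.2 • fderiv ℝ Φ z ((0, 0, 1), 0) +
      v.2 • fderiv ℝ Φ z (0, 1) := by
    intro v
    simp only [← map_smul, ← map_add]; simp
  obtain ⟨v, hv⟩ := hs ((1, 0, 0), 0)
  obtain ⟨w, hw⟩ := hs ((0, 0, 1), 0)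
  rw [e] at hv hw
  have v1 := congrArg (fun y : Vars => y.1.1) hv
  have v2 := congrArg (fun y : Vars => y.1.2.2) hv
  have w1 := congrArg (fun y : Vars => y.1.1) hw
  have w2 := congrArg (fun y : Vars => y.1.2.2) hw
  simp [x1, x2, hu] at v1 v2 w1 w2
  intro h0
  set B := (fderiv ℝ Φ z ((0, 0, 1), 0)).1.2.2
  set C := (fderiv ℝ Φ z ((1, 0, 0), 0)).1.1
  set A := (fderiv ℝ Φ z ((1, 0, 0), 0)).1.2.2
  set E := (fderiv ℝ Φ z ((0, 0, 1), 0)).1.1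
  -- Multiplicativity of the determinant: `v` and `w` are preimages of `∂_T` and `∂_Y`, and their
  -- `x` and `u` components do not influence `T` and `Y`.
  have k : (B * C - A * E) * (v.1.1 * w.1.2.2 - v.1.2.2 * w.1.1) = 1 := by
    calc _ = (v.1.1 * C + v.1.2.2 * E) * (w.1.1 * A + w.1.2.2 * B) -
          (v.1.1 * A + v.1.2.2 * B) * (w.1.1 * C + w.1.2.2 * E) := by ring
      _ = 1 := by rw [v1, v2, w1, w2]; ring
  rw [h0] at k
  simp at k

theorem exists_line (hz : z ∈ Φ.source) : ∃ ε > 0, ∀ s ∈ Ioo (z.1.2.1 - ε) (z.1.2.1 + ε),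
    (((z.1.1, s, z.1.2.2), z.2) : Vars) ∈ Φ.source := by
  have hc : Continuous fun s : ℝ => (((z.1.1, s, z.1.2.2), z.2) : Vars) := by fun_prop
  obtain ⟨ε, hε, h⟩ := Metric.mem_nhds_iff.1
    (hc.continuousAt.preimage_mem_nhds (x := z.1.2.1) (Φ.open_source.mem_nhds hz))
  refine ⟨ε, hε, fun s hs => h ?_⟩
  rwa [Real.ball_eq_Ioo]

theorem hasDerivAt_line (s t y u : ℝ) :
    HasDerivAt (fun s : ℝ => (((t, s, y), u) : Vars)) ((0, 1, 0), 0) s :=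
  ((hasDerivAt_const s t).prodMk ((hasDerivAt_id s).prodMk (hasDerivAt_const s y))).prodMk
    (hasDerivAt_const s u)

/-- First derivatives of the transformed `t` and `y` with respect to `t` and `y` do not depend
on `x`. -/
theorem fderiv_const_on_line (hΦ : IsPointTransformation Φ) (L : Vars →L[ℝ] ℝ)
    (hL : ∀ z ∈ Φ.source, L (fderiv ℝ Φ z ((0, 1, 0), 0)) = 0) {a b t y u : ℝ}
    (hab : ∀ s ∈ Ioo a b, (((t, s, y), u) : Vars) ∈ Φ.source) (v : Vars) {s s' : ℝ}
    (hs : s ∈ Ioo a b) (hs' : s' ∈ Ioo a b) :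
    L (fderiv ℝ Φ ((t, s, y), u) v) = L (fderiv ℝ Φ ((t, s', y), u) v) := by
  have hd : ∀ s ∈ Ioo a b, HasDerivAt (fun s => L (fderiv ℝ Φ ((t, s, y), u) v)) 0 s := by
    intro s hs
    have hz := hab s hs
    have h1 : HasFDerivAt (fderiv ℝ Φ) (fderiv ℝ (fderiv ℝ Φ) ((t, s, y), u)) ((t, s, y), u) :=
      (((hΦ.contDiffAt hz).fderiv_right (m := 1) (by norm_cast)).differentiableAt
        (by simp)).hasFDerivAt
    have h2 := (L.hasFDerivAt.comp _ (h1.clm_apply (hasFDerivAt_const v _))).comp_hasDerivAt s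
      (hasDerivAt_line s t y u)
    refine h2.congr_deriv ?_
    -- By symmetry of the second derivative, the `x`-derivative of the `v`-derivative is the
    -- `v`-derivative of an `x`-derivative that vanishes identically.
    have h3 := fderiv_fderiv_apply_eq_zero hΦ hz L ((0, 1, 0), 0) v
      (eventually_of_mem (Φ.open_source.mem_nhds hz) hL)
    have h4 := ((hΦ.contDiffAt hz).isSymmSndFDerivAt (by simp; norm_cast)).eq v ((0, 1, 0), 0)
    rw [h4] at h3
    simpa using h3
  exact isOpen_Ioo.is_const_of_deriv_eq_zero isPreconnected_Ioo
    (fun s hs => (hd s hs).differentiableAt.differentiableWithinAt)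
    (fun s hs => (hd s hs).deriv) hs hs'

/-- Admissible transformations between equations of the class preserve the exponent or reflect
it; in the latter case their domains do not meet the hyperplane `x = 0`. -/
theorem tgt_eq_of_admissible (hT : (⟨β, Φ, β'⟩ : Arrow ℝ) ∈ equivalenceGroupoid classF')
    (hz : z ∈ Φ.source) : β' = β ∨ (β' = 5 - β ∧ z.1.2.1 ≠ 0) := by
  obtain ⟨ε, hε, hline⟩ := exists_line hz
  have hmem : z.1.2.1 ∈ Ioo (z.1.2.1 - ε) (z.1.2.1 + ε) := ⟨by linarith, by linarith⟩
  have hT1 := fderiv_const_on_line hT.1 (tCoord.comp (ContinuousLinearMap.fst ℝ Base ℝ))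
    (fun z hz => (determining_equations_extended hT hz).1.1) hline
  have hY1 := fderiv_const_on_line hT.1 (yCoord.comp (ContinuousLinearMap.fst ℝ Base ℝ))
    (fun z hz => (determining_equations_extended hT hz).1.2) hline
  have hJ := jacobian_ne_zero hT hz
  have hξ : ∀ s ∈ Ioo (z.1.2.1 - ε) (z.1.2.1 + ε),
      HasDerivAt (fun s => (Φ ((z.1.1, s, z.1.2.2), z.2)).1.2.1)
        (fderiv ℝ Φ ((z.1.1, s, z.1.2.2), z.2) ((0, 1, 0), 0)).1.2.1 s := by
    intro s hs
    have h := ((hT.1.contDiffAt (hline s hs)).differentiableAt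
      (by simp)).hasFDerivAt.comp_hasDerivAt s (hasDerivAt_line s z.1.1 z.1.2.2 z.2)
    exact h.fst.snd.fst
  -- The four coefficients can be frozen at `z`, since they are constant on the line.
  have h1 : ∀ s ∈ Ioo (z.1.2.1 - ε) (z.1.2.1 + ε), (Φ ((z.1.1, s, z.1.2.2), z.2)).1.2.1 *
      ((fderiv ℝ Φ z ((1, 0, 0), 0)).1.1 + s * (fderiv ℝ Φ z ((0, 0, 1), 0)).1.1) =
      (fderiv ℝ Φ z ((1, 0, 0), 0)).1.2.2 + s * (fderiv ℝ Φ z ((0, 0, 1), 0)).1.2.2 := by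
    intro s hs
    have k := (determining_equations_extended hT (hline s hs)).2.2
    have t1 := hT1 ((1, 0, 0), 0) hs hmem
    have t2 := hT1 ((0, 0, 1), 0) hs hmem
    have y1 := hY1 ((1, 0, 0), 0) hs hmem
    have y2 := hY1 ((0, 0, 1), 0) hs hmem
    simp at t1 t2 y1 y2
    rw [t1, t2, y1, y2] at k
    exact k
  have h2 : ∀ s ∈ Ioo (z.1.2.1 - ε) (z.1.2.1 + ε), s ≠ 0 →
      (Φ ((z.1.1, s, z.1.2.2), z.2)).1.2.1 ≠ 0 ∧
      |s| ^ β * (fderiv ℝ Φ ((z.1.1, s, z.1.2.2), z.2) ((0, 1, 0), 0)).1.2.1 ^ 2 =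
        |(Φ ((z.1.1, s, z.1.2.2), z.2)).1.2.1| ^ β' *
        ((fderiv ℝ Φ z ((1, 0, 0), 0)).1.1 + s * (fderiv ℝ Φ z ((0, 0, 1), 0)).1.1) := by
    intro s hs hs0
    refine ⟨x_ne_zero_of_admissible hT (hline s hs) hs0, ?_⟩
    have k := (determining_equations hT (hline s hs) hs0).2.2
    have t1 := hT1 ((1, 0, 0), 0) hs hmem
    have t2 := hT1 ((0, 0, 1), 0) hs hmem
    simp at t1 t2
    rw [fderiv_direction] at k
    simp at k
    rw [t1, t2] at k
    exact k
  obtain ⟨hne, -, r1, r2⟩ := exponent_relations (by linarith) hJ hξ h1 h2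
  have hl := hne _ hmem
  have hz1 := h1 _ hmem
  have hx := x_ne_zero_iff_of_admissible hT hz
  change (Φ z).1.2.1 * _ = _ at hz1
  set B := (fderiv ℝ Φ z ((0, 0, 1), 0)).1.2.2
  set C := (fderiv ℝ Φ z ((1, 0, 0), 0)).1.1
  set A := (fderiv ℝ Φ z ((1, 0, 0), 0)).1.2.2
  set E := (fderiv ℝ Φ z ((0, 0, 1), 0)).1.1
  by_cases hβ : β' = β
  · exact Or.inl hβ
  have hβ1 : β - β' ≠ 0 := sub_ne_zero.2 (Ne.symm hβ)
  have hβ2 : β' = 5 - β := by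
    by_contra h
    have h5 : 5 - β - β' ≠ 0 := fun h' => h (by linarith)
    -- Both `β - β'` and `5 - β - β'` are nonzero here, so `BC` and `EA` could only vanish together,
    -- which the Jacobian forbids. With all four coefficients nonzero, the remaining relations
    -- demand both `β = 5` and `β = 0`.
    have hBC : B * C ≠ 0 := by
      intro h0
      rw [h0, mul_zero, zero_eq_mul] at r1
      exact hJ (by linarith [r1.resolve_left h5])
    have hEA : E * A ≠ 0 := by
      intro h0
      rw [h0, mul_zero, mul_eq_zero] at r1
      exact hBC (r1.resolve_left hβ1)
    have hβ5 : β = 5 := by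
      have := (mul_eq_zero.1 r2).resolve_right
        (mul_ne_zero (left_ne_zero_of_mul hBC) (left_ne_zero_of_mul hEA))
      linarith
    have hβ0 : β = 0 := by
      have := (exponent_relations (by linarith) hJ hξ h1 h2).2.1
      exact (mul_eq_zero.1 this).resolve_right
        (mul_ne_zero (right_ne_zero_of_mul hEA) (right_ne_zero_of_mul hBC))
    linarith
  refine Or.inr ⟨hβ2, hx.2 fun h0 => ?_⟩
  -- A point with `x = X = 0` would force `A = 0`, then `BC = 0`, contradicting the Jacobian.
  by_cases hx0 : z.1.2.1 = 0
  · rw [hx0, zero_mul, add_zero] at hl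
    rw [h0, hx0] at hz1
    have hA : A = 0 := by linarith
    have : B * C = 0 := by
      rw [hA, mul_zero, mul_zero] at r1
      exact (mul_eq_zero.1 r1).resolve_left hβ1
    exact hJ (by rw [this, hA]; ring)
  · exact hx.1 hx0 h0

end Point

/-! ### Derivatives along lines parallel to the `x`-axis -/

theorem hasDerivAt_slice {f : Base → ℝ} {t x y : ℝ} (hf : DifferentiableAt ℝ f (t, x, y)) :
    HasDerivAt (fun s => f (t, s, y)) (fderiv ℝ f (t, x, y) (0, 1, 0)) x :=
  hf.hasFDerivAt.comp_hasDerivAt x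
    ((hasDerivAt_const x t).prodMk ((hasDerivAt_id x).prodMk (hasDerivAt_const x y)))

theorem eventually_hasDerivAt_slice {f : Base → ℝ} {t x y : ℝ}
    (hf : ContDiffAt ℝ ∞ f (t, x, y)) :
    ∀ᶠ s in 𝓝 x, HasDerivAt (fun s => f (t, s, y)) (fderiv ℝ f (t, s, y) (0, 1, 0)) s := by
  have hc : ContinuousAt (fun s : ℝ => ((t, s, y) : Base)) x := by fun_prop
  exact (hc.eventually ((hf.of_le (m := 1) (by norm_cast)).eventually (by simp))).mono
    fun s hs => hasDerivAt_slice (hs.differentiableAt (by simp))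

theorem hasDerivAt_fderiv_slice {f : Base → ℝ} {t x y : ℝ} (hf : ContDiffAt ℝ ∞ f (t, x, y)) :
    HasDerivAt (fun s => fderiv ℝ f (t, s, y) (0, 1, 0))
      (fderiv ℝ (fderiv ℝ f) (t, x, y) (0, 1, 0) (0, 1, 0)) x := by
  have h1 : HasFDerivAt (fderiv ℝ f) (fderiv ℝ (fderiv ℝ f) (t, x, y)) (t, x, y) :=
    ((hf.fderiv_right (m := 1) (by norm_cast)).differentiableAt (by simp)).hasFDerivAt
  have h2 := (h1.clm_apply (hasFDerivAt_const ((0, 1, 0) : Base) _)).comp_hasDerivAt x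
    ((hasDerivAt_const x t).prodMk ((hasDerivAt_id x).prodMk (hasDerivAt_const x y)))
  exact h2.congr_deriv (by simp)

theorem hasDerivAt_direction {f : Base → ℝ} {t x y a b : ℝ} (hf : DifferentiableAt ℝ f (t, x, y)) :
    HasDerivAt (fun s => f (t + s * a, x, y + s * b)) (fderiv ℝ f (t, x, y) (a, 0, b)) 0 := by
  have e : ((t + 0 * a, x, y + 0 * b) : Base) = (t, x, y) := by simp
  have h1 : HasFDerivAt f (fderiv ℝ f (t, x, y)) (t + 0 * a, x, y + 0 * b) := by
    rw [e]; exact hf.hasFDerivAt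
  have h2 : HasDerivAt (fun s : ℝ => ((t + s * a, x, y + s * b) : Base)) (a, 0, b) 0 := by
    have k : ∀ t a : ℝ, HasDerivAt (fun s => t + s * a) a 0 := fun t a => by
      simpa using ((hasDerivAt_id (0 : ℝ)).mul_const a).const_add t
    exact (k t a).prodMk ((hasDerivAt_const _ x).prodMk (k y b))
  exact h1.comp_hasDerivAt (0 : ℝ) h2

/-! ### Shifts -/

theorem MapsGraphAt.shiftVars_eq {c : ℝ} {f g : Base → ℝ} {t x y : ℝ} {q : Base}
    (h : MapsGraphAt (shiftVars c) f (t, x, y) g q) :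
    q = (t, x + c, y + c * t) ∧
      ∀ᶠ p' in 𝓝 ((t, x, y) : Base), f p' = g (p'.1, p'.2.1 + c, p'.2.2 + c * p'.1) := by
  obtain ⟨-, -, -, hq, he⟩ := h
  exact ⟨(congrArg Prod.fst hq).symm, he⟩

/-- A Galilean boost: it preserves `∂_x` and carries `∂_t + x∂_y` to `∂_t + (x + c)∂_y`, the same
operator in the new variables. -/
theorem pushesForward_shiftVars (c : ℝ) (θ : ℝ × ℝ) :
    PushesForward (shiftVars c) (classF θ) (classF (θ.1 + c, θ.2)) := by
  rintro f ⟨t, x, y⟩ g q h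
  obtain ⟨rfl, he⟩ := h.shiftVars_eq
  obtain ⟨hf, hg, -, -, -⟩ := h
  have hc1 : ContinuousAt (fun s : ℝ => ((t, s, y) : Base)) x := by fun_prop
  have hc2 : ContinuousAt (fun s : ℝ => ((t + s * 1, x, y + s * x) : Base)) 0 := by fun_prop
  have ht : Tendsto (fun s : ℝ => s + c) (𝓝 x) (𝓝 (x + c)) :=
    (continuous_id.add continuous_const).tendsto x
  have e0 : fderiv ℝ f (t, x, y) (1, 0, x) =
      fderiv ℝ g (t, x + c, y + c * t) (1, 0, x + c) := by
    refine (hasDerivAt_direction (hf.differentiableAt (by simp))).unique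
      ((hasDerivAt_direction (hg.differentiableAt (by simp))).congr_of_eventuallyEq ?_)
    have hc3 := hc2.tendsto
    simp only [zero_mul, add_zero] at hc3
    filter_upwards [hc3.eventually he] with s hs
    rw [hs]
    ring_nf
  have e1 : ∀ᶠ s in 𝓝 x, fderiv ℝ f (t, s, y) (0, 1, 0) =
      fderiv ℝ g (t, s + c, y + c * t) (0, 1, 0) := by
    filter_upwards [eventually_hasDerivAt_slice hf, ht.eventually (eventually_hasDerivAt_slice hg),
      (hc1.eventually he).eventually_nhds] with s h1 h2 h3
    exact h1.unique ((h2.comp_add_const s c).congr_of_eventuallyEq h3)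
  have e2 := (hasDerivAt_fderiv_slice hf).unique
    (((hasDerivAt_fderiv_slice hg).comp_add_const x c).congr_of_eventuallyEq e1)
  rw [jet2_mem_classF hf, jet2_mem_classF hg, ← e0, ← e2]
  simp

theorem isPointTransformation_shiftVars (c : ℝ) : IsPointTransformation (shiftVars c) := by
  refine ⟨⟨0, trivial⟩, ContDiff.contDiffOn ?_, ContDiff.contDiffOn ?_⟩
  · change ContDiff ℝ ∞ fun z : Vars => (((z.1.1, z.1.2.1 + c, z.1.2.2 + c * z.1.1), z.2) : Vars)
    fun_prop
  · change ContDiff ℝ ∞ fun z : Vars => (((z.1.1, z.1.2.1 - c, z.1.2.2 - c * z.1.1), z.2) : Vars)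
    fun_prop

theorem contDiff_shift : ContDiff ℝ ∞ (fun q : ℝ × (Vars × (ℝ × ℝ)) => shift q.1 q.2) := by
  change ContDiff ℝ ∞ fun q : ℝ × (Vars × (ℝ × ℝ)) =>
    ((((q.2.1.1.1, q.2.1.1.2.1 + q.1, q.2.1.1.2.2 + q.1 * q.2.1.1.1), q.2.1.2),
      (q.2.2.1 + q.1, q.2.2.2)) : Vars × (ℝ × ℝ))
  fun_prop

theorem shift_zero : shift 0 = OpenPartialHomeomorph.refl (Vars × (ℝ × ℝ)) := by
  refine OpenPartialHomeomorph.ext _ _ (fun w => ?_) (fun w => ?_) rfl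
  · simp [shift]
  · simp [shift]

theorem shift_add (c c' : ℝ) : shift (c + c') = (shift c).trans (shift c') := by
  refine OpenPartialHomeomorph.ext _ _ (fun w => ?_) (fun w => ?_) ?_
  · simp [shift]; ring_nf; simp
  · simp [shift]; ring_nf; simp
  · simp [shift]

theorem shift_neg (c : ℝ) : shift (-c) = (shift c).symm := by
  refine OpenPartialHomeomorph.ext _ _ (fun w => ?_) (fun w => ?_) rfl
  · simp [shift, sub_eq_add_neg]
  · simp [shift]

theorem shift_injective : Function.Injective shift := by
  intro c c' h
  have := congrArg (fun Ψ : OpenPartialHomeomorph (Vars × (ℝ × ℝ)) (Vars × (ℝ × ℝ)) =>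
    (Ψ 0).1.1.2.1) h
  simpa [shift] using this

theorem isPointTransformation_shift (c : ℝ) : IsPointTransformation (shift c) := by
  refine ⟨⟨0, trivial⟩, ContDiff.contDiffOn ?_, ContDiff.contDiffOn ?_⟩
  · exact contDiff_shift.comp (contDiff_const.prodMk contDiff_id)
  · rw [← shift_neg]
    exact contDiff_shift.comp (contDiff_const.prodMk contDiff_id)

theorem isProjection_shift (c : ℝ) : IsProjection (shift c) (shiftVars c) := by
  refine ⟨?_, fun w _ => rfl⟩
  ext w; simp [shift, shiftVars]

theorem shift_mem_equivalenceGroup (c : ℝ) : shift c ∈ equivalenceGroup classF :=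
  ⟨isPointTransformation_shift c, shiftVars c, isProjection_shift c, fun θ =>
    ⟨(θ.1 + c, θ.2), fun _ _ => rfl, isPointTransformation_shiftVars c,
      pushesForward_shiftVars c θ⟩⟩

theorem pushesForward_gauge (α β : ℝ) :
    PushesForward (shiftVars (-α)) (classF (α, β)) (classF' β) := by
  have := pushesForward_shiftVars (-α) (α, β)
  rwa [add_neg_cancel, classF_zero] at this

theorem gaugeArrow_mem_equivalenceGroupoid (θ : ℝ × ℝ) :
    gaugeArrow θ ∈ equivalenceGroupoid classF := by
  refine ⟨isPointTransformation_shiftVars _, ?_⟩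
  have := pushesForward_gauge θ.1 θ.2
  rwa [← classF_zero] at this

theorem gaugeArrow_mem_actionGroupoid (θ : ℝ × ℝ) :
    gaugeArrow θ ∈ actionGroupoid (equivalenceGroup classF) := by
  refine ⟨shift (-θ.1), shift_mem_equivalenceGroup _, isProjection_shift _, fun z _ => ?_⟩
  change (shiftVars (-θ.1) z, (θ.1 + -θ.1, θ.2)) = _
  rw [add_neg_cancel]; rfl

/-! ### Identification and composition of admissible transformations -/

section Groupoid

variable {Φ Φ' Ψ : OpenPartialHomeomorph Vars Vars} {f g : Base → ℝ} {p q : Base}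

theorem MapsGraphAt.congr (h : MapsGraphAt Φ f p g q) (hΦ : Φ ≈ Φ') : MapsGraphAt Φ' f p g q := by
  obtain ⟨hf, hg, hz, hq, he⟩ := h
  refine ⟨hf, hg, hΦ.1 ▸ hz, (hΦ.2 hz).symm.trans hq, ?_⟩
  filter_upwards [he, (contDiffAt_graph hf).continuousAt.eventually
    (Φ.open_source.mem_nhds hz)] with p' h1 h2
  rwa [← hΦ.2 h2]

theorem mem_equivalenceGroupoid_congr {Θ : Type*} {L : EqClass Θ} {θ θ' : Θ}
    (h : (⟨θ, Φ, θ'⟩ : Arrow Θ) ∈ equivalenceGroupoid L) (hΦ : Φ ≈ Φ') :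
    (⟨θ, Φ', θ'⟩ : Arrow Θ) ∈ equivalenceGroupoid L :=
  ⟨h.1.congr hΦ, fun f p g q hm => h.2 f p g q (hm.congr (Setoid.symm hΦ))⟩

/-- Graphs of functions can be pulled back by `Ψ`. -/
def PullsBackGraphs (Ψ : OpenPartialHomeomorph Vars Vars) : Prop :=
  ∀ (g : Base → ℝ) (q : Base) (w : Vars), w ∈ Ψ.source → Ψ w = (q, g q) → ContDiffAt ℝ ∞ g q →
    ∃ h : Base → ℝ, ContDiffAt ℝ ∞ h w.1 ∧
      ∀ᶠ w' in 𝓝 w, ((Ψ w').2 = g (Ψ w').1 ↔ w'.2 = h w'.1)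

theorem pullsBackGraphs_refl : PullsBackGraphs (OpenPartialHomeomorph.refl Vars) := by
  intro g q w _ hw hg
  have hw' : w = (q, g q) := hw
  subst hw'
  exact ⟨g, hg, Eventually.of_forall fun w' => Iff.rfl⟩

/-- A composite can carry a graph to a graph through a hypersurface that is not a graph, where
admissibility of the factors says nothing. Pulling back the final graph by `Ψ` rules this out. -/
theorem MapsGraphAt.exists_intermediate (hΨ : PullsBackGraphs Ψ)
    (h : MapsGraphAt (Φ.trans Ψ) f p g q) :
    ∃ k, MapsGraphAt Φ f p k (Φ (p, f p)).1 ∧ MapsGraphAt Ψ k (Φ (p, f p)).1 g q := by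
  obtain ⟨hf, hg, hz, hq, he⟩ := h
  rw [OpenPartialHomeomorph.trans_source] at hz
  have hq' : Ψ (Φ (p, f p)) = (q, g q) := hq
  obtain ⟨k, hk, hiff⟩ := hΨ g q _ hz.2 hq' hg
  have hkw : (Φ (p, f p)).2 = k (Φ (p, f p)).1 := hiff.self_of_nhds.1 (by rw [hq'])
  have hw : ((Φ (p, f p)).1, k (Φ (p, f p)).1) = Φ (p, f p) := Prod.ext rfl hkw.symm
  refine ⟨k, ⟨hf, hk, hz.1, hw.symm, ?_⟩, hk, hg, ?_, ?_, ?_⟩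
  · have hc : ContinuousAt (fun p' => Φ (p', f p')) p :=
      ContinuousAt.comp (f := fun p' => ((p', f p') : Vars)) (Φ.continuousAt hz.1)
        (contDiffAt_graph hf).continuousAt
    filter_upwards [he, hc.eventually hiff] with p' h1 h2
    exact h2.1 h1
  · rw [hw]; exact hz.2
  · rw [hw]; exact hq'
  · have hc := (contDiffAt_graph hk).continuousAt.tendsto
    rw [hw] at hc
    filter_upwards [hc.eventually hiff] with q' h1
    exact h1.2 rfl

theorem PullsBackGraphs.congr (h : PullsBackGraphs Φ) (hΦ : Φ ≈ Φ') : PullsBackGraphs Φ' := by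
  intro g q w hw hq hg
  rw [← hΦ.1] at hw
  rw [← hΦ.2 hw] at hq
  obtain ⟨k, hk, hiff⟩ := h g q w hw hq hg
  refine ⟨k, hk, ?_⟩
  filter_upwards [hiff, Φ.open_source.mem_nhds hw] with w' h1 h2
  rwa [← hΦ.2 h2]

theorem PullsBackGraphs.trans (h : PullsBackGraphs Φ) (h' : PullsBackGraphs Φ') :
    PullsBackGraphs (Φ.trans Φ') := by
  intro g q w hw hq hg
  rw [OpenPartialHomeomorph.trans_source] at hw
  obtain ⟨k, hk, hiff⟩ := h' g q (Φ w) hw.2 hq hg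
  have hkw : (Φ w).2 = k (Φ w).1 := hiff.self_of_nhds.1 (by
    have hq' : Φ' (Φ w) = (q, g q) := hq
    rw [hq'])
  obtain ⟨l, hl, hiff'⟩ := h k (Φ w).1 w hw.1 (Prod.ext rfl hkw) hk
  refine ⟨l, hl, ?_⟩
  filter_upwards [hiff', (Φ.continuousAt hw.1).eventually hiff] with w' h1 h2
  exact h2.trans h1

theorem trans_mem_equivalenceGroupoid {Θ : Type*} {L : EqClass Θ} {θ₁ θ₂ θ₃ : Θ}
    (h₁ : (⟨θ₁, Φ, θ₂⟩ : Arrow Θ) ∈ equivalenceGroupoid L)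
    (h₂ : (⟨θ₂, Ψ, θ₃⟩ : Arrow Θ) ∈ equivalenceGroupoid L)
    (hne : (Φ.trans Ψ).source.Nonempty) (hΨ : PullsBackGraphs Ψ) :
    (⟨θ₁, Φ.trans Ψ, θ₃⟩ : Arrow Θ) ∈ equivalenceGroupoid L := by
  refine ⟨h₁.1.trans h₂.1 hne, fun f p g q hm => ?_⟩
  obtain ⟨k, hk1, hk2⟩ := MapsGraphAt.exists_intermediate hΨ hm
  exact (h₁.2 _ _ _ _ hk1).trans (h₂.2 _ _ _ _ hk2)

/-- The version with the well-behaved factor first, obtained by passing to inverses. -/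
theorem trans_mem_equivalenceGroupoid' {Θ : Type*} {L : EqClass Θ} {θ₁ θ₂ θ₃ : Θ}
    (h₁ : (⟨θ₁, Ψ, θ₂⟩ : Arrow Θ) ∈ equivalenceGroupoid L)
    (h₂ : (⟨θ₂, Φ, θ₃⟩ : Arrow Θ) ∈ equivalenceGroupoid L)
    (hne : (Ψ.trans Φ).source.Nonempty) (hΨ : PullsBackGraphs Ψ.symm) :
    (⟨θ₁, Ψ.trans Φ, θ₃⟩ : Arrow Θ) ∈ equivalenceGroupoid L := by
  have hne' : (Φ.symm.trans Ψ.symm).source.Nonempty := by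
    rw [← OpenPartialHomeomorph.trans_symm_eq_symm_trans_symm]
    exact hne.elim fun z hz => ⟨_, (Ψ.trans Φ).map_source hz⟩
  have h := symm_mem_equivalenceGroupoid (trans_mem_equivalenceGroupoid
    (symm_mem_equivalenceGroupoid h₂) (symm_mem_equivalenceGroupoid h₁) hne' hΨ)
  rwa [← OpenPartialHomeomorph.trans_symm_eq_symm_trans_symm,
    OpenPartialHomeomorph.symm_symm] at h

theorem IsProjection.eqOnSource {Θ : Type*} [TopologicalSpace Θ] [Nonempty Θ]
    {P P' : OpenPartialHomeomorph (Vars × Θ) (Vars × Θ)} (h : IsProjection P Φ)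
    (h' : IsProjection P' Φ') (hP : P ≈ P') : Φ ≈ Φ' := by
  obtain ⟨θ⟩ := ‹Nonempty Θ›
  have hs : Φ.source = Φ'.source := by
    have h1 : Φ.source ×ˢ (univ : Set Θ) = Φ'.source ×ˢ univ := by
      rw [← h.1, ← h'.1]; exact hP.1
    ext z
    have := Set.ext_iff.1 h1 (z, θ)
    simpa using this
  refine ⟨hs, fun z hz => ?_⟩
  have m : (z, θ) ∈ P.source := by rw [h.1]; exact ⟨hz, trivial⟩
  have m' : (z, θ) ∈ P'.source := by rw [h'.1, ← hs]; exact ⟨hz, trivial⟩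
  rw [← h.2 _ m, ← h'.2 _ m', hP.2 m]

theorem mem_equivalenceGroup_congr {Θ : Type*} [NormedAddCommGroup Θ] [NormedSpace ℝ Θ]
    {L : EqClass Θ} {P P' : OpenPartialHomeomorph (Vars × Θ) (Vars × Θ)}
    (h : P ∈ equivalenceGroup L) (hP : P ≈ P') : P' ∈ equivalenceGroup L := by
  obtain ⟨h1, Φ, h2, h3⟩ := h
  refine ⟨h1.congr hP, Φ, ⟨hP.1 ▸ h2.1, fun w hw => ?_⟩, fun θ => ?_⟩
  · have hw' : w ∈ P.source := by have := hP.1; rwa [this]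
    rw [← hP.2 hw', h2.2 w hw']
  · obtain ⟨θ', h4, h5⟩ := h3 θ
    refine ⟨θ', fun z hz => ?_, h5⟩
    have hw' : (z, θ) ∈ P.source := by rw [h2.1]; exact ⟨hz, trivial⟩
    rw [← hP.2 hw', h4 z hz]

theorem actionGroupoid_subset {Θ : Type*} [NormedAddCommGroup Θ] [NormedSpace ℝ Θ]
    (L : EqClass Θ) : actionGroupoid (equivalenceGroup L) ⊆ equivalenceGroupoid L := by
  rintro ⟨θ, Φ, θ'⟩ ⟨P, ⟨hP, Φ', h1, h2⟩, h3, h4⟩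
  have he : Φ' ≈ Φ := h1.eqOnSource h3 (Setoid.refl P)
  obtain ⟨θ'', h5, h6⟩ := h2 θ
  have : θ'' = θ' := by
    obtain ⟨z, hz⟩ := h6.1.1
    have hz' : z ∈ Φ.source := by have := he.1; rwa [← this]
    rw [← h5 z hz, h4 z hz']
  subst this
  exact mem_equivalenceGroupoid_congr h6 he

end Groupoid

/-! ### The inversion -/

theorem eventually_sign_eq {x : ℝ} (hx : x ≠ 0) : ∀ᶠ s in 𝓝 x, s ≠ 0 ∧ Real.sign s = Real.sign x := by
  rcases lt_or_gt_of_ne hx with h | h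
  · filter_upwards [gt_mem_nhds h] with s hs
    exact ⟨hs.ne, by rw [Real.sign_of_neg hs, Real.sign_of_neg h]⟩
  · filter_upwards [lt_mem_nhds h] with s hs
    exact ⟨hs.ne', by rw [Real.sign_of_pos hs, Real.sign_of_pos h]⟩

/-- The projection of the inversion to the space of variables, with the domain `x ≠ 0`. -/
noncomputable def inversionVars : OpenPartialHomeomorph Vars Vars where
  toFun z := (inversionFun (z, 0)).1
  invFun z := (inversionFun (z, 0)).1
  source := {z | z.1.2.1 ≠ 0}
  target := {z | z.1.2.1 ≠ 0}
  map_source' z hz := inversionFun_mapsTo (z, 0) hz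
  map_target' z hz := inversionFun_mapsTo (z, 0) hz
  left_inv' z hz := congrArg Prod.fst (inversionFun_invol (z, 0) hz)
  right_inv' z hz := congrArg Prod.fst (inversionFun_invol (z, 0) hz)
  open_source := isOpen_ne_fun (by fun_prop) continuous_const
  open_target := isOpen_ne_fun (by fun_prop) continuous_const
  continuousOn_toFun := (continuousOn_inversionFun.comp
    (f := fun z : Vars => ((z, 0) : Vars × ℝ)) (by fun_prop) fun z hz => hz).fst
  continuousOn_invFun := (continuousOn_inversionFun.comp
    (f := fun z : Vars => ((z, 0) : Vars × ℝ)) (by fun_prop) fun z hz => hz).fst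

theorem inversionVars_apply (z : Vars) : inversionVars z =
    ((z.1.2.2 * Real.sign z.1.2.1, 1 / z.1.2.1, z.1.1 * Real.sign z.1.2.1), z.2 / z.1.2.1) := rfl

theorem inversion_symm : inversion.symm = inversion := rfl

theorem inversionVars_involutive {z : Vars} (hz : z.1.2.1 ≠ 0) :
    inversionVars (inversionVars z) = z := inversionVars.left_inv hz

theorem contDiffOn_inversionFun : ContDiffOn ℝ ∞ inversionFun {w : Vars × ℝ | w.1.1.2.1 ≠ 0} := by
  intro w hw
  have hw' : w.1.1.2.1 ≠ 0 := hw
  set σ := Real.sign w.1.1.2.1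
  have h1 : ContDiffAt ℝ ∞ (fun w : Vars × ℝ => ((((w.1.1.2.2 * σ, 1 / w.1.1.2.1, w.1.1.1 * σ),
      w.1.2 / w.1.1.2.1), 5 - w.2) : Vars × ℝ)) w := by
    fun_prop (disch := exact hw')
  refine (h1.congr_of_eventuallyEq ?_).contDiffWithinAt
  have hc : ContinuousAt (fun w : Vars × ℝ => w.1.1.2.1) w := by fun_prop
  filter_upwards [hc.eventually (eventually_sign_eq hw')] with w' h
  simp only [inversionFun, h.2, σ]

theorem isPointTransformation_inversion : IsPointTransformation inversion :=
  ⟨⟨(((0, 1, 0), 0), 0), one_ne_zero (α := ℝ)⟩, contDiffOn_inversionFun, contDiffOn_inversionFun⟩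

theorem isPointTransformation_inversionVars : IsPointTransformation inversionVars := by
  have h : ContDiffOn ℝ ∞ (fun z : Vars => (inversionFun (z, 0)).1) {z | z.1.2.1 ≠ 0} :=
    (contDiffOn_inversionFun.comp (f := fun z : Vars => ((z, 0) : Vars × ℝ))
      (contDiff_id.prodMk contDiff_const).contDiffOn fun z hz => hz).fst
  exact ⟨⟨((0, 1, 0), 0), one_ne_zero⟩, h, h⟩

theorem isProjection_inversion : IsProjection inversion inversionVars := by
  refine ⟨?_, fun w _ => rfl⟩
  ext w
  exact (and_iff_left trivial).symm

/-- The base part does not involve `u` and the fibre part is linear in `u`, so the image equation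
can be solved for `u` explicitly. -/
theorem pullsBackGraphs_inversionVars : PullsBackGraphs inversionVars := by
  intro g q w hw hq hg
  have hx : w.1.2.1 ≠ 0 := hw
  have hJ : ContDiffAt ℝ ∞ (fun p : Base => (inversionVars (p, 0)).1) w.1 := by
    have h := isPointTransformation_inversionVars.contDiffAt (z := (w.1, 0)) hx
    exact (h.comp w.1 (contDiffAt_id.prodMk contDiffAt_const)).fst
  have hg' : ContDiffAt ℝ ∞ g (inversionVars (w.1, 0)).1 := by
    have : (inversionVars (w.1, 0)).1 = q := congrArg Prod.fst hq
    rwa [this]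
  refine ⟨fun p => p.2.1 * g (inversionVars (p, 0)).1,
    ContDiffAt.mul (by fun_prop) (hg'.comp w.1 hJ), ?_⟩
  have hc : ContinuousAt (fun w : Vars => w.1.2.1) w := by fun_prop
  filter_upwards [hc.eventually (eventually_sign_eq hx)] with w' h
  change w'.2 / w'.1.2.1 = g (inversionVars (w'.1, 0)).1 ↔ _
  rw [div_eq_iff h.1, mul_comm]

/-- The origin of the 5: under the inversion `u_t + x u_y` acquires the factor `x² sgn x` and `u_xx`
the factor `x⁻³`, and the discrepancy `x⁵` must be absorbed by the power of `|x|`. -/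
theorem sign_mul_abs_rpow {x : ℝ} (hx : x ≠ 0) (β : ℝ) :
    x ^ 5 * |1 / x| ^ (5 - β) = Real.sign x * |x| ^ β := by
  have h0 : 0 < |x| := abs_pos.2 hx
  have h1 : |1 / x| ^ (5 - β) = |x| ^ β / |x| ^ 5 := by
    rw [abs_div, abs_one, one_div, Real.inv_rpow h0.le, ← Real.rpow_neg h0.le, neg_sub,
      Real.rpow_sub h0]
    norm_cast
  have h2 : x ^ 5 = Real.sign x * |x| ^ 5 := by
    rcases lt_or_gt_of_ne hx with h | h
    · rw [Real.sign_of_neg h, abs_of_neg h]; ring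
    · rw [Real.sign_of_pos h, abs_of_pos h]; ring
  rw [h1, h2]
  field_simp

theorem pushesForward_inversionVars (β : ℝ) :
    PushesForward inversionVars (classF' β) (classF' (5 - β)) := by
  rintro f ⟨t, x, y⟩ g q ⟨hf, hg, hz, hq, he⟩
  have hx : x ≠ 0 := hz
  have hq' : (y * Real.sign x, 1 / x, t * Real.sign x) = q := congrArg Prod.fst hq
  subst hq'
  set σ := Real.sign x with hσ
  have hσ2 : σ * σ = 1 := by
    rcases lt_or_gt_of_ne hx with h | h
    · rw [hσ, Real.sign_of_neg h]; norm_num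
    · rw [hσ, Real.sign_of_pos h]; norm_num
  have hev : ∀ᶠ p' in 𝓝 ((t, x, y) : Base), f p' = p'.2.1 * g (p'.2.2 * σ, 1 / p'.2.1, p'.1 * σ) := by
    have hc : ContinuousAt (fun p : Base => p.2.1) (t, x, y) := by fun_prop
    filter_upwards [he, hc.eventually (eventually_sign_eq hx)] with p' h1 h2
    simp only [inversionVars_apply, h2.2] at h1
    rw [div_eq_iff h2.1] at h1
    rw [h1, mul_comm]
  -- Exchanging `t` and `y` up to the locally constant sign turns `(1, 0, x)` into `(x * σ) • (1, 0,
  -- 1 / x)`; the second factor `x` comes from the multiplier of `u`.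
  have e0 : fderiv ℝ f (t, x, y) (1, 0, x) = x ^ 2 * σ *
      fderiv ℝ g (y * σ, 1 / x, t * σ) (1, 0, 1 / x) := by
    have hc2 : ContinuousAt (fun s : ℝ => ((t + s * 1, x, y + s * x) : Base)) 0 := by fun_prop
    have hc3 := hc2.tendsto
    simp only [zero_mul, add_zero] at hc3
    have h1 := (hasDerivAt_direction (t := y * σ) (x := 1 / x) (y := t * σ) (a := x * σ) (b := σ)
      (hg.differentiableAt (by simp))).const_mul x
    have h2 : ((x * σ, 0, σ) : Base) = (x * σ) • (1, 0, 1 / x) := by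
      simp; field_simp
    rw [h2, map_smul, smul_eq_mul] at h1
    rw [(hasDerivAt_direction (hf.differentiableAt (by simp))).unique
      (h1.congr_of_eventuallyEq ?_)]
    · ring
    · filter_upwards [hc3.eventually hev] with s hs
      rw [hs]
      ring_nf
  have hc1 : ContinuousAt (fun s : ℝ => ((t, s, y) : Base)) x := by fun_prop
  have hinv : ContinuousAt (fun s : ℝ => 1 / s) x := by fun_prop (disch := exact hx)
  have e1 : ∀ᶠ s in 𝓝 x, fderiv ℝ f (t, s, y) (0, 1, 0) =
      g (y * σ, 1 / s, t * σ) + s * (fderiv ℝ g (y * σ, 1 / s, t * σ) (0, 1, 0) * (-1 / s ^ 2)) := by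
    filter_upwards [eventually_hasDerivAt_slice hf,
      hinv.eventually (eventually_hasDerivAt_slice hg), (hc1.eventually hev).eventually_nhds,
      isOpen_ne.mem_nhds hx] with s h1 h2 h3 h4
    have h5 := (hasDerivAt_id s).mul
      (h2.comp s ((hasDerivAt_const s (1 : ℝ)).div (hasDerivAt_id s) h4))
    have h6 := h1.unique (h5.congr_of_eventuallyEq h3)
    rw [h6]
    simp
  have e2 : fderiv ℝ (fderiv ℝ f) (t, x, y) (0, 1, 0) (0, 1, 0) =
      fderiv ℝ (fderiv ℝ g) (y * σ, 1 / x, t * σ) (0, 1, 0) (0, 1, 0) / x ^ 3 := by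
    have k0 := (hasDerivAt_const x (1 : ℝ)).div (hasDerivAt_id x) hx
    have k1 := (hasDerivAt_slice (hg.differentiableAt (by simp))).comp x k0
    have k2 := (hasDerivAt_fderiv_slice hg).comp x k0
    have k3 := (hasDerivAt_const x (-1 : ℝ)).div ((hasDerivAt_id x).pow 2) (pow_ne_zero 2 hx)
    have k4 := k1.add ((hasDerivAt_id x).mul (k2.mul k3))
    rw [(hasDerivAt_fderiv_slice hf).unique (k4.congr_of_eventuallyEq e1)]
    simp
    field_simp
    ring
  rw [jet2_mem_classF' hf, jet2_mem_classF' hg, e0, e2]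
  simp only [ne_eq, hx, not_false_eq_true, true_and, one_div_ne_zero hx]
  have hσ0 : σ ≠ 0 := left_ne_zero_of_mul (hσ2 ▸ one_ne_zero)
  have hkey := sign_mul_abs_rpow hx β
  rw [← hσ] at hkey
  set G := fderiv ℝ (fderiv ℝ g) (y * σ, 1 / x, t * σ) (0, 1, 0) (0, 1, 0)
  set m := fderiv ℝ g (y * σ, 1 / x, t * σ) (1, 0, 1 / x)
  have hb : |x| ^ β = σ * (x ^ 5 * |1 / x| ^ (5 - β)) := by
    rw [hkey, ← mul_assoc, hσ2, one_mul]
  have hr : |x| ^ β * (G / x ^ 3) = x ^ 2 * σ * (|1 / x| ^ (5 - β) * G) := by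
    rw [hb]; field_simp
  rw [hr]
  exact mul_right_inj' (mul_ne_zero (pow_ne_zero 2 hx) hσ0)

theorem inversionVars_mem_equivalenceGroupoid (β : ℝ) :
    (⟨β, inversionVars, 5 - β⟩ : Arrow ℝ) ∈ equivalenceGroupoid classF' :=
  ⟨isPointTransformation_inversionVars, pushesForward_inversionVars β⟩

/-! ### The group generated by the inversion -/

theorem inversion_trans_inversion_trans :
    (inversion.trans inversion).trans inversion ≈ inversion := by
  refine ⟨?_, fun w hw => ?_⟩
  · ext w
    simp only [OpenPartialHomeomorph.trans_source, mem_inter_iff, mem_preimage]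
    exact ⟨fun h => h.1.1, fun h => ⟨⟨h, inversion.map_source h⟩,
      inversion.map_source (inversion.map_source h)⟩⟩
  · exact congrArg inversion (inversionFun_invol w hw.1.1)

/-- The inversion is an involution only on `x ≠ 0`, so its square is a proper restriction of the
identity and counts as a third element. -/
theorem generated_inversion_cases {Ψ : OpenPartialHomeomorph (Vars × ℝ) (Vars × ℝ)}
    (h : Generated inversion Ψ) :
    Ψ ≈ OpenPartialHomeomorph.refl _ ∨ Ψ ≈ inversion ∨ Ψ ≈ inversion.trans inversion := by
  induction h with
  | base => exact Or.inr (Or.inl (Setoid.refl _))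
  | one => exact Or.inl (Setoid.refl _)
  | inv _ ih =>
    refine ih.imp (fun h => ?_) (Or.imp (fun h => ?_) fun h => ?_)
    · exact OpenPartialHomeomorph.EqOnSource.symm' h
    · exact OpenPartialHomeomorph.EqOnSource.symm' h
    · have := OpenPartialHomeomorph.EqOnSource.symm' h
      rwa [OpenPartialHomeomorph.trans_symm_eq_symm_trans_symm, inversion_symm] at this
  | comp _ _ ih ih' =>
    have h3 := inversion_trans_inversion_trans
    have h3' : inversion.trans (inversion.trans inversion) ≈ inversion := by
      rwa [← OpenPartialHomeomorph.trans_assoc]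
    have h4 : (inversion.trans inversion).trans (inversion.trans inversion) ≈
        inversion.trans inversion := by
      rw [← OpenPartialHomeomorph.trans_assoc]
      exact OpenPartialHomeomorph.EqOnSource.trans' h3 (Setoid.refl _)
    rcases ih with h | h | h <;> rcases ih' with h' | h' | h' <;>
      have k := OpenPartialHomeomorph.EqOnSource.trans' h h'
    · exact Or.inl (by simpa using k)
    · exact Or.inr (Or.inl (by simpa using k))
    · exact Or.inr (Or.inr (by simpa using k))
    · exact Or.inr (Or.inl (by simpa using k))
    · exact Or.inr (Or.inr k)
    · exact Or.inr (Or.inl (Setoid.trans k h3'))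
    · exact Or.inr (Or.inr (by simpa using k))
    · exact Or.inr (Or.inl (Setoid.trans k h3))
    · exact Or.inr (Or.inr (Setoid.trans k h4))
  | congr _ he ih =>
    exact ih.imp (Setoid.trans (Setoid.symm he))
      (Or.imp (Setoid.trans (Setoid.symm he)) (Setoid.trans (Setoid.symm he)))

theorem isProjection_refl : IsProjection (OpenPartialHomeomorph.refl (Vars × ℝ))
    (OpenPartialHomeomorph.refl Vars) :=
  ⟨by simp, fun _ _ => rfl⟩

theorem isProjection_inversion_trans :
    IsProjection (inversion.trans inversion) (inversionVars.trans inversionVars) := by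
  refine ⟨?_, fun w _ => rfl⟩
  ext w
  exact (and_iff_left trivial).symm

theorem refl_mem_equivalenceGroupoid {Θ : Type*} (L : EqClass Θ) (θ : Θ) :
    (⟨θ, OpenPartialHomeomorph.refl Vars, θ⟩ : Arrow Θ) ∈ equivalenceGroupoid L := by
  refine ⟨⟨⟨0, trivial⟩, contDiffOn_id, contDiffOn_id⟩, ?_⟩
  rintro f p g q ⟨-, -, -, hq, he⟩
  have hq' : p = q := congrArg Prod.fst hq
  subst hq'
  have he' : f =ᶠ[𝓝 p] g := he
  have hd : ∀ {f g : Base → ℝ} (v : Base), f =ᶠ[𝓝 p] g →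
      (fun p' => fderiv ℝ f p' v) =ᶠ[𝓝 p] fun p' => fderiv ℝ g p' v := fun v h =>
    (Filter.EventuallyEq.fderiv (𝕜 := ℝ) h).mono fun p' hp' => congrArg (fun L : Base →L[ℝ] ℝ => L v) hp'
  have e : jet2 f p = jet2 g p := by
    simp only [jet2, Jet2.mk.injEq, true_and]
    exact ⟨he'.eq_of_nhds, (hd _ he').eq_of_nhds, (hd _ he').eq_of_nhds, (hd _ he').eq_of_nhds,
      (hd _ (hd _ he')).eq_of_nhds, (hd _ (hd _ he')).eq_of_nhds, (hd _ (hd _ he')).eq_of_nhds,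
      (hd _ (hd _ he')).eq_of_nhds, (hd _ (hd _ he')).eq_of_nhds, (hd _ (hd _ he')).eq_of_nhds⟩
  rw [e]

theorem refl_mem_equivalenceGroup :
    OpenPartialHomeomorph.refl (Vars × ℝ) ∈ equivalenceGroup classF' :=
  ⟨⟨⟨0, trivial⟩, contDiffOn_id, contDiffOn_id⟩, _, isProjection_refl,
    fun β => ⟨β, fun _ _ => rfl, refl_mem_equivalenceGroupoid classF' β⟩⟩

theorem inversion_mem_equivalenceGroup : inversion ∈ equivalenceGroup classF' :=
  ⟨isPointTransformation_inversion, _, isProjection_inversion,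
    fun β => ⟨5 - β, fun _ _ => rfl, inversionVars_mem_equivalenceGroupoid β⟩⟩

theorem inversion_trans_mem_equivalenceGroup :
    inversion.trans inversion ∈ equivalenceGroup classF' := by
  have h1 : (((0, 1, 0), 0) : Vars) ∈ inversionVars.source := one_ne_zero (α := ℝ)
  have h2 : ((((0, 1, 0), 0), 0) : Vars × ℝ) ∈ inversion.source := one_ne_zero (α := ℝ)
  refine ⟨isPointTransformation_inversion.trans isPointTransformation_inversion
    ⟨_, h2, inversion.map_source h2⟩, _, isProjection_inversion_trans, fun β => ⟨β, fun z _ => ?_, ?_⟩⟩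
  · change 5 - (5 - β) = β
    ring
  · have h := trans_mem_equivalenceGroupoid (inversionVars_mem_equivalenceGroupoid β)
      (inversionVars_mem_equivalenceGroupoid (5 - β)) ⟨_, h1, inversionVars.map_source h1⟩
      pullsBackGraphs_inversionVars
    rwa [sub_sub_cancel] at h

theorem generatedGroup_inversion_subset :
    generatedGroup inversion ⊆ equivalenceGroup classF' := by
  intro Ψ hΨ
  rcases generated_inversion_cases hΨ with h | h | h
  · exact mem_equivalenceGroup_congr refl_mem_equivalenceGroup (Setoid.symm h)
  · exact mem_equivalenceGroup_congr inversion_mem_equivalenceGroup (Setoid.symm h)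
  · exact mem_equivalenceGroup_congr inversion_trans_mem_equivalenceGroup (Setoid.symm h)

theorem pullsBackGraphs_of_mem_actionGroupoid {T : Arrow ℝ}
    (hT : T ∈ actionGroupoid (generatedGroup inversion)) :
    PullsBackGraphs T.map ∧ PullsBackGraphs T.map.symm := by
  obtain ⟨Ψ, hΨ, hp, -⟩ := hT
  have key : ∀ {Φ : OpenPartialHomeomorph Vars Vars}, Φ ≈ T.map → Φ.symm = Φ →
      PullsBackGraphs Φ → PullsBackGraphs T.map ∧ PullsBackGraphs T.map.symm := by
    intro Φ h1 h2 h3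
    refine ⟨h3.congr h1, ?_⟩
    rw [← h2] at h3
    exact h3.congr (OpenPartialHomeomorph.EqOnSource.symm' h1)
  rcases generated_inversion_cases hΨ with h | h | h
  · exact key (isProjection_refl.eqOnSource hp (Setoid.symm h)) rfl pullsBackGraphs_refl
  · exact key (isProjection_inversion.eqOnSource hp (Setoid.symm h)) rfl
      pullsBackGraphs_inversionVars
  · exact key (isProjection_inversion_trans.eqOnSource hp (Setoid.symm h)) rfl
      (pullsBackGraphs_inversionVars.trans pullsBackGraphs_inversionVars)

/-! ### Semi-normalization -/

theorem actionGroupoid_inversion_subset :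
    actionGroupoid (generatedGroup inversion) ⊆ equivalenceGroupoid classF' := by
  rintro T ⟨Ψ, hΨ, h⟩
  exact actionGroupoid_subset classF' ⟨Ψ, generatedGroup_inversion_subset hΨ, h⟩

theorem refl_mem_actionGroupoid (β : ℝ) : (⟨β, OpenPartialHomeomorph.refl Vars, β⟩ : Arrow ℝ) ∈
    actionGroupoid (generatedGroup inversion) :=
  ⟨_, Generated.one, isProjection_refl, fun _ _ => rfl⟩

theorem inversionVars_mem_actionGroupoid (β : ℝ) : (⟨β, inversionVars, 5 - β⟩ : Arrow ℝ) ∈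
    actionGroupoid (generatedGroup inversion) :=
  ⟨_, Generated.base, isProjection_inversion, fun _ _ => rfl⟩

/-- When the exponent changes, `Φ` is the inversion followed by `inversionVars.trans Φ`. The source
of `Φ` avoids `x = 0`, so the composite has exactly the domain of `Φ`. The converse inclusion needs
graphs to survive the inverse of the first factor. -/
theorem equivalenceGroupoid_eq_action_fundamental : equivalenceGroupoid classF' =
    frobeniusProduct (actionGroupoid (generatedGroup inversion)) (fundamentalGroupoid classF') := by
  refine Subset.antisymm ?_ ?_
  · rintro ⟨β, Φ, β'⟩ hT
    by_cases hβ : β' = β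
    · subst hβ
      refine ⟨_, refl_mem_actionGroupoid β', _, ⟨hT, rfl⟩, rfl, ?_, rfl, rfl, ?_⟩
      · simpa using hT.1.1
      · simp only [OpenPartialHomeomorph.refl_trans]; exact Setoid.refl _
    · have hs : ∀ z ∈ Φ.source, β' = 5 - β ∧ z.1.2.1 ≠ 0 := fun z hz =>
        (tgt_eq_of_admissible hT hz).resolve_left hβ
      obtain ⟨z, hz⟩ := hT.1.1
      obtain ⟨hβ', -⟩ := hs z hz
      subst hβ'
      have hmem : ∀ z ∈ Φ.source, inversionVars z ∈ (inversionVars.trans Φ).source := by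
        intro z hz
        refine ⟨inversionVars.map_source (hs z hz).2, ?_⟩
        change inversionVars (inversionVars z) ∈ Φ.source
        rwa [inversionVars_involutive (hs z hz).2]
      have h2 : (⟨5 - β, inversionVars.trans Φ, 5 - β⟩ : Arrow ℝ) ∈ equivalenceGroupoid classF' := by
        have h1 := inversionVars_mem_equivalenceGroupoid (5 - β)
        rw [sub_sub_cancel] at h1
        exact trans_mem_equivalenceGroupoid' h1 hT ⟨_, hmem z hz⟩ pullsBackGraphs_inversionVars
      refine ⟨_, inversionVars_mem_actionGroupoid β, _, ⟨h2, rfl⟩, rfl,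
        ⟨z, (hs z hz).2, hmem z hz⟩, rfl, rfl, ?_, fun z hz => ?_⟩
      · ext z
        refine ⟨fun hz => ⟨(hs z hz).2, hmem z hz⟩, fun hz => ?_⟩
        have h3 : inversionVars (inversionVars z) ∈ Φ.source := hz.2.2
        rwa [inversionVars_involutive hz.1] at h3
      · exact congrArg Φ (inversionVars_involutive (hs z hz).2).symm
  · rintro ⟨β, Φ, β'⟩ ⟨⟨_, Φ₁, β₁⟩, h₁, ⟨_, Φ₂, _⟩, h₂, rfl, hne, rfl, rfl, he⟩
    exact mem_equivalenceGroupoid_congr (trans_mem_equivalenceGroupoid'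
      (actionGroupoid_inversion_subset h₁) h₂.1 hne
      (pullsBackGraphs_of_mem_actionGroupoid h₁).2) (Setoid.symm he)

/-- The mirror argument: here it is the image of `Φ` that must avoid `x = 0`. -/
theorem equivalenceGroupoid_eq_fundamental_action : equivalenceGroupoid classF' =
    frobeniusProduct (fundamentalGroupoid classF') (actionGroupoid (generatedGroup inversion)) := by
  refine Subset.antisymm ?_ ?_
  · rintro ⟨β, Φ, β'⟩ hT
    by_cases hβ : β' = β
    · subst hβ
      refine ⟨_, ⟨hT, rfl⟩, _, refl_mem_actionGroupoid β', rfl, ?_, rfl, rfl, ?_⟩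
      · simpa using hT.1.1
      · simp only [OpenPartialHomeomorph.trans_refl]; exact Setoid.refl _
    · have hs : ∀ z ∈ Φ.source, β' = 5 - β ∧ (Φ z).1.2.1 ≠ 0 := fun z hz =>
        ((tgt_eq_of_admissible hT hz).resolve_left hβ).imp_right
          (x_ne_zero_iff_of_admissible hT hz).1
      obtain ⟨z, hz⟩ := hT.1.1
      obtain ⟨hβ', -⟩ := hs z hz
      subst hβ'
      have h2 : (⟨β, Φ.trans inversionVars, β⟩ : Arrow ℝ) ∈ equivalenceGroupoid classF' := by
        have h1 := inversionVars_mem_equivalenceGroupoid (5 - β)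
        rw [sub_sub_cancel] at h1
        exact trans_mem_equivalenceGroupoid hT h1 ⟨z, hz, (hs z hz).2⟩
          pullsBackGraphs_inversionVars
      have hmem : ∀ z ∈ Φ.source,
          z ∈ ((Φ.trans inversionVars).trans inversionVars).source := fun z hz =>
        ⟨⟨hz, (hs z hz).2⟩, inversionVars.map_source (hs z hz).2⟩
      refine ⟨_, ⟨h2, rfl⟩, _, inversionVars_mem_actionGroupoid β, rfl,
        ⟨z, hmem z hz⟩, rfl, rfl, ?_, fun z hz => ?_⟩
      · ext z
        exact ⟨hmem z, fun hz => hz.1.1⟩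
      · exact (inversionVars_involutive (hs z hz).2).symm
  · rintro ⟨β, Φ, β'⟩ ⟨⟨_, Φ₁, β₁⟩, h₁, ⟨_, Φ₂, _⟩, h₂, rfl, hne, rfl, rfl, he⟩
    exact mem_equivalenceGroupoid_congr (trans_mem_equivalenceGroupoid h₁.1
      (actionGroupoid_inversion_subset h₂) hne
      (pullsBackGraphs_of_mem_actionGroupoid h₂).1) (Setoid.symm he)

/-! ### Discreteness of the inversion -/

/-- Follow the image of the exponent 0 along the family: by the classification it is 0 or 5, it
varies continuously, and it would have to pass from 0 to 5. -/
theorem isDiscreteEquivalence_inversion : IsDiscreteEquivalence classF' inversion := by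
  refine ⟨inversion_mem_equivalenceGroup, ?_⟩
  rintro ⟨γ, hγ, hopen, hcont, h0, h1⟩
  have key : ∀ s, ∃ θ : ℝ, (θ = 0 ∨ θ = 5) ∧ (∃ z, (z, (0 : ℝ)) ∈ (γ s).source) ∧
      ∀ z, (z, (0 : ℝ)) ∈ (γ s).source → (γ s (z, 0)).2 = θ := by
    intro s
    obtain ⟨-, Φ, hp, hΦ⟩ := hγ s
    obtain ⟨θ, h2, h3⟩ := hΦ 0
    obtain ⟨z, hz⟩ := h3.1.1
    refine ⟨θ, ?_, ⟨z, ?_⟩, fun z hz => h2 z ?_⟩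
    · rcases tgt_eq_of_admissible h3 hz with h | h
      · exact Or.inl h
      · exact Or.inr (by simpa using h.1)
    · rw [hp.1]; exact ⟨hz, trivial⟩
    · rw [hp.1] at hz; exact hz.1
  choose F hF hne hval using key
  have hFc : Continuous F := by
    refine continuous_iff_continuousAt.2 fun s => ?_
    obtain ⟨z, hz⟩ := hne s
    have hn := hopen.mem_nhds (x := (s, (z, (0 : ℝ)))) hz
    have hi : ContinuousAt (fun s' : unitInterval => (s', (z, (0 : ℝ)))) s := by fun_prop
    -- The domains vary with the parameter, but openness of their union keeps one point `z` usable
    -- for all nearby parameters.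
    have hc : ContinuousAt (fun s' => (γ s' (z, 0)).2) s :=
      (ContinuousAt.comp (f := fun s' : unitInterval => (s', (z, (0 : ℝ))))
        (hcont.continuousAt hn) hi).snd
    refine hc.congr ?_
    filter_upwards [hi.eventually hn] with s' hs'
    exact hval s' z hs'
  have hF0 : F 0 = 0 := by
    obtain ⟨z, hz⟩ := hne 0
    rw [← hval 0 z hz, h0.2 hz]; rfl
  have hF1 : F 1 = 5 := by
    obtain ⟨z, hz⟩ := hne 1
    rw [← hval 1 z hz, h1.2 hz]
    exact sub_zero 5
  obtain ⟨s, hs⟩ := intermediate_value_univ 0 1 hFc (show (1 : ℝ) ∈ Icc (F 0) (F 1) by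
    rw [hF0, hF1]; norm_num)
  rcases hF s with h | h <;> rw [hs] at h <;> norm_num at h

end KolmogorovBackward

theorem mainTheorem4 :
    ((∀ c : ℝ, shift c ∈ equivalenceGroup classF) ∧
      shift 0 = OpenPartialHomeomorph.refl (Vars × (ℝ × ℝ)) ∧
      (∀ c c' : ℝ, shift (c + c') = (shift c).trans (shift c')) ∧
      (∀ c : ℝ, shift (-c) = (shift c).symm) ∧
      ContDiff ℝ ∞ (fun q : ℝ × (Vars × (ℝ × ℝ)) => shift q.1 q.2) ∧
      Function.Injective shift) ∧
    ((∀ c : ℝ, IsProjection (shift c) (shiftVars c)) ∧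
      (∀ β : ℝ, classF (0, β) = classF' β) ∧
      (∀ θ : ℝ × ℝ, gaugeArrow θ ∈ actionGroupoid (equivalenceGroup classF)) ∧
      (∀ θ : ℝ × ℝ, gaugeArrow θ ∈ equivalenceGroupoid classF) ∧
      Set.range (fun θ => (gaugeArrow θ).src) = Set.univ ∧
      (∀ α β : ℝ, PushesForward (shiftVars (-α)) (classF (α, β)) (classF' β)) ∧
      Set.range (fun θ => classF (gaugeArrow θ).tgt) = Set.range classF') ∧
    IsDiscreteEquivalence classF' inversion ∧
    IsSemiNormalizedWrt classF' (generatedGroup inversion) := by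
  refine ⟨⟨shift_mem_equivalenceGroup, shift_zero, shift_add, shift_neg, contDiff_shift,
    shift_injective⟩, ⟨isProjection_shift, classF_zero, gaugeArrow_mem_actionGroupoid,
    gaugeArrow_mem_equivalenceGroupoid, Set.range_id, pushesForward_gauge, ?_⟩,
    isDiscreteEquivalence_inversion, generatedGroup_inversion_subset,
    equivalenceGroupoid_eq_action_fundamental, equivalenceGroupoid_eq_fundamental_action⟩
  ext L
  constructor
  · rintro ⟨θ, rfl⟩
    exact ⟨θ.2, (classF_zero θ.2).symm⟩
  · rintro ⟨β, rfl⟩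
    exact ⟨(0, β), classF_zero β⟩
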